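/- Let $\mathcal C$ be a finite non-empty set of $m$ candidates and let $\mathbb N=\{1,2,\dots\}$ be the set of potential voters. A profile $A$ assigns to every voter $i$ of a finite non-empty electorate $N_A\subset\mathbb N$ a non-empty ballot $A_i\subseteq\mathcal C$. Profiles $A,A'$ are disjoint if $N_A\cap N_{A'}=\emptyset$; then $A+A'$ is their union. $jA$ denotes a profile consisting of $j$ disjoint copies of $A$ (the names of the voters being irrelevant). A committee is a subset of $\mathcal C$. An ABC rule $f$ assigns to every profile $A$ and every $k\in\{0,\dots,m\}$ a non-empty set $f(A,k)$ of committees of size $k$. Axioms for an ABC rule $f$: - $f$ is proper if it is anonymous ($f(\pi(A),k)=f(A,k)$ for all permutations $\pi$ of $\mathbb N$), neutral ($f(\tau(A),k)=\{\tau(W)\colon W\in f(A,k)\}$ for all permutations $\tau$ of $\mathcal C$), continuous (for all disjoint profiles $A,A'$ and all $k$ with $|f(A,k)|=1$ there is an integer $j\ge 1$ with $f(jA+A',k)=f(A,k)$, where the copies are disjoint from $A'$), and non-imposing (for every committee $W$ there is a profile $A$ with $f(A,|W|)=\{W\}$). - $f$ is independent of losers if $W\in f(A,|W|)$ implies $W\in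 f(A',|W|)$ for all committees $W$ and all profiles $A,A'$ with $N_A=N_{A'}$ and, for all $i\in N_A$, $W\cap A_i=W\cap A_i'$ and $A_i'\subseteq A_i$. - $f$ is committee separable if, with $C_A=\bigcup_{i\in N_A}A_i$, for all disjoint profiles $A,B$ with $C_B=\mathcal C\setminus C_A$ and all committees $W$, $W\in f(A+B,|W|)$ implies $W\cap C_A\in f(A,|W\cap C_A|)$ and $W\cap C_B\in f(B,|W\cap C_B|)$. - $f$ is consistently committee monotone if there is a function $g$ assigning to every profile $A$ and committee $W\ne\mathcal C$ a (possibly empty) set $g(A,W)\subseteq\mathcal C\setminus W$ such that (i) $g$ generates $f$: for all $A$ and $k\in\{1,\dots,m\}$, $g(A,W)\neq\emptyset$ for all $W\in f(A,k-1)$, and $f(A,k)=\{W\cup\{x\}\colon W\in f(A,k-1),\ x\in g(A,W)\}$; and (ii) $g$ is consistent: for all disjoint $A,A'$ and all $W\neq\mathcal C$, if $g(A,W)\cap g(A',W)\ne\emptyset$ and $g(A+A',W)\neq\emptyset$, then $g(A+A',W)=g(A,W)\cap g(A',W)$. For a function $v$ from pairs of a ballot and a committee to $\mathbb R$, let $s_v(A,W)=\sum_{i\in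 N_A}v(A_i,W)$. The sequential valuation rule given by $v$ is defined by $f(A,0)=\{\emptyset\}$ and, for $1\le k\le m$, $f(A,k)=\{W\cup\{x\}\colon W\in f(A,k-1),\ x\in\mathcal C\setminus W,\ s_v(A,W\cup\{x\})\ge s_v(A,W\cup\{y\})\text{ for all }y\in\mathcal C\setminus W\}$. It is - a sequential Thiele rule if one can take $v(A_i,W)=h(|A_i\cap W|)$ with $h:\{0,\dots,m\}\to\mathbb R$ non-negative, non-decreasing and $h(1)>h(0)$; - a step-dependent sequential Thiele rule if one can take $v(A_i,W)=h(|A_i\cap W|,|W|)$ with $h:\{0,\dots,m\}\times\{1,\dots,m\}\to\mathbb R$ non-negative, non-decreasing in the first argument, and such that for every $y\in\{1,\dots,m-1\}$ there is $x\in\{1,\dots,y\}$ with $h(x,y)>h(x-1,y)$. The following statements hold for every ABC rule $f$. (1) $f$ is a step-dependent sequential Thiele rule if and only if it is consistently committee monotone, independent of losers, and proper. (2) $f$ is a sequential Thiele rule if and only if it is consistently committee monotone, independent of losers, committee separable, and proper. -/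

import Mathlib

/-- An approval profile over the candidates `C`: a finite nonempty electorate `voters` taken from
the infinite set of potential voters `{1, 2, 3, …}`, and a nonempty approval ballot for every member
of the electorate. Non-voters carry the placeholder `∅` (which is not a ballot), so that a profile
is determined by its electorate and the ballots of the electorate. -/
@[ext] structure Profile (C : Type*) where
  voters : Finset ℕ+
  ballot : ℕ+ → Finset C
  voters_nonempty : voters.Nonempty
  ballot_nonempty_iff : ∀ i, (ballot i).Nonempty ↔ i ∈ voters

namespace Profile

variable {C : Type*}

/-- `A + A'`; only meaningful (and only used) for profiles with disjoint electorates. -/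
def add (A A' : Profile C) : Profile C where
  voters := A.voters ∪ A'.voters
  ballot i := if i ∈ A.voters then A.ballot i else A'.ballot i
  voters_nonempty := A.voters_nonempty.mono Finset.subset_union_left
  ballot_nonempty_iff i := by
    by_cases h : i ∈ A.voters
    · simp [h, A.ballot_nonempty_iff]
    · simp [h, A'.ballot_nonempty_iff]

/-- The profile `π(A)`, in which voter `π i` reports the ballot that `i` reports in `A`. -/
def permuteVoters (π : Equiv.Perm ℕ+) (A : Profile C) : Profile C where
  voters := A.voters.map π.toEmbedding
  ballot i := A.ballot (π.symm i)
  voters_nonempty := A.voters_nonempty.map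
  ballot_nonempty_iff i := by
    rw [A.ballot_nonempty_iff, Finset.mem_map_equiv]

/-- The profile `τ(A)`, in which voter `i` reports the image under `τ` of her ballot in `A`. -/
def permuteCandidates (τ : Equiv.Perm C) (A : Profile C) : Profile C where
  voters := A.voters
  ballot i := (A.ballot i).map τ.toEmbedding
  voters_nonempty := A.voters_nonempty
  ballot_nonempty_iff i := by
    rw [Finset.map_nonempty, A.ballot_nonempty_iff]

variable [DecidableEq C]

/-- The set of candidates that are approved by some voter of `A`. -/
def approved (A : Profile C) : Finset C := A.voters.biUnion A.ballot

/-- `B` consists of `j` disjoint copies of `A`, the names of the voters being irrelevant: every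
ballot is cast in `B` by exactly `j` times as many voters as in `A`. -/
def IsCopies (j : ℕ) (A B : Profile C) : Prop :=
  ∀ S : Finset C,
    (B.voters.filter fun i => B.ballot i = S).card
      = j * (A.voters.filter fun i => A.ballot i = S).card

end Profile

/-- An approval-based committee (ABC) voting rule: to every profile and every target size
`k ∈ {0, …, m}`, where `m` is the number of candidates, it assigns a nonempty set of committees of
size `k`. (For `k > m` the set of chosen committees is necessarily empty and plays no role.) -/
structure ABCRule (C : Type*) [Fintype C] where
  chosen : Profile C → ℕ → Set (Finset C)
  card_eq : ∀ A k, ∀ W ∈ chosen A k, W.card = k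
  chosen_nonempty : ∀ A k, k ≤ Fintype.card C → (chosen A k).Nonempty

/-- A generator function: to a profile `A` and a committee `W` it assigns a (possibly empty) set of
candidates outside `W`. (For `W` the set of all candidates this set is necessarily empty.) -/
structure GeneratorFunction (C : Type*) where
  next : Profile C → Finset C → Finset C
  disjoint : ∀ A W, Disjoint (next A W) W

namespace GeneratorFunction

variable {C : Type*} [Fintype C] [DecidableEq C]

/-- The generator function `g` generates the ABC voting rule `f`. -/
def Generates (g : GeneratorFunction C) (f : ABCRule C) : Prop :=
  ∀ (A : Profile C) (k : ℕ), k < Fintype.card C →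
    (∀ W ∈ f.chosen A k, (g.next A W).Nonempty) ∧
    f.chosen A (k + 1) = {W' | ∃ W ∈ f.chosen A k, ∃ x ∈ g.next A W, W' = insert x W}

/-- Consistency of a generator function. -/
def Consistent (g : GeneratorFunction C) : Prop :=
  ∀ (A A' : Profile C) (W : Finset C), Disjoint A.voters A'.voters → W ≠ Finset.univ →
    (g.next A W ∩ g.next A' W).Nonempty → (g.next (A.add A') W).Nonempty →
    g.next (A.add A') W = g.next A W ∩ g.next A' W

end GeneratorFunction

namespace ABCRule

variable {C : Type*} [Fintype C] [DecidableEq C]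

def Anonymous (f : ABCRule C) : Prop :=
  ∀ (A : Profile C) (k : ℕ) (π : Equiv.Perm ℕ+), k ≤ Fintype.card C →
    f.chosen A k = f.chosen (A.permuteVoters π) k

def Neutral (f : ABCRule C) : Prop :=
  ∀ (A : Profile C) (k : ℕ) (τ : Equiv.Perm C), k ≤ Fintype.card C →
    f.chosen (A.permuteCandidates τ) k = (fun W => W.map τ.toEmbedding) '' f.chosen A k

/-- Continuity: if `W` is the only committee chosen for `A`, then it is also the only committee
chosen when sufficiently many copies of `A` are added to `A'`. -/
def Continuous (f : ABCRule C) : Prop :=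
  ∀ (A A' : Profile C) (k : ℕ) (W : Finset C), Disjoint A.voters A'.voters →
    k ≤ Fintype.card C → f.chosen A k = {W} →
    ∃ j : ℕ, 1 ≤ j ∧ ∀ B : Profile C, Profile.IsCopies j A B → Disjoint B.voters A'.voters →
      f.chosen (B.add A') k = {W}

def NonImposing (f : ABCRule C) : Prop :=
  ∀ W : Finset C, ∃ A : Profile C, f.chosen A W.card = {W}

/-- Proper ABC voting rules. -/
structure Proper (f : ABCRule C) : Prop where
  anonymous : f.Anonymous
  neutral : f.Neutral
  continuous : f.Continuous
  nonImposing : f.NonImposing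

def IndependentOfLosers (f : ABCRule C) : Prop :=
  ∀ (A A' : Profile C) (W : Finset C), A.voters = A'.voters →
    (∀ i ∈ A.voters, W ∩ A.ballot i = W ∩ A'.ballot i ∧ A'.ballot i ⊆ A.ballot i) →
    W ∈ f.chosen A W.card → W ∈ f.chosen A' W.card

def CommitteeSeparable (f : ABCRule C) : Prop :=
  ∀ (A B : Profile C) (W : Finset C), Disjoint A.voters B.voters →
    B.approved = (A.approved)ᶜ → W ∈ f.chosen (A.add B) W.card →
    W ∩ A.approved ∈ f.chosen A (W ∩ A.approved).card ∧
    W ∩ B.approved ∈ f.chosen B (W ∩ B.approved).card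

def ConsistentlyCommitteeMonotone (f : ABCRule C) : Prop :=
  ∃ g : GeneratorFunction C, g.Consistent ∧ g.Generates f

end ABCRule

/-- The score `∑ i ∈ N_A, v(A_i, W)` of the committee `W` in the profile `A` for the valuation
function `v` (whose first argument is a ballot and whose second is a committee). -/
def score {C : Type*} (v : Finset C → Finset C → ℝ) (A : Profile C) (W : Finset C) : ℝ :=
  ∑ i ∈ A.voters, v (A.ballot i) W

/-- `f` is the sequential valuation rule that is given by the valuation function `v`. -/
def ABCRule.IsSequentialValuationRuleOf {C : Type*} [Fintype C] [DecidableEq C]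
    (f : ABCRule C) (v : Finset C → Finset C → ℝ) : Prop :=
  ∀ A : Profile C, f.chosen A 0 = {∅} ∧
    ∀ k : ℕ, k < Fintype.card C →
      f.chosen A (k + 1) = {W' | ∃ W ∈ f.chosen A k, ∃ x ∉ W,
        (∀ y ∉ W, score v A (insert y W) ≤ score v A (insert x W)) ∧ W' = insert x W}

/-- Thiele counting functions `h : {0, …, m} → ℝ`; values of `h` elsewhere are irrelevant. -/
structure IsThieleCountingFunction (m : ℕ) (h : ℕ → ℝ) : Prop where
  nonneg : ∀ x ≤ m, 0 ≤ h x
  mono : ∀ x x', x ≤ x' → x' ≤ m → h x ≤ h x'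
  zero_lt_one : h 0 < h 1

/-- Step-dependent Thiele counting functions `h : {0, …, m} × {1, …, m} → ℝ`; values of `h`
elsewhere are irrelevant. -/
structure IsStepDependentThieleCountingFunction (m : ℕ) (h : ℕ → ℕ → ℝ) : Prop where
  nonneg : ∀ x y, x ≤ m → 1 ≤ y → y ≤ m → 0 ≤ h x y
  mono : ∀ x x' y, x ≤ x' → x' ≤ m → 1 ≤ y → y ≤ m → h x y ≤ h x' y
  exists_lt : ∀ y, 1 ≤ y → y < m → ∃ x, 1 ≤ x ∧ x ≤ y ∧ h (x - 1) y < h x y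

namespace ABCRule

variable {C : Type*} [Fintype C] [DecidableEq C]

/-- Sequential Thiele rules. -/
def IsSequentialThieleRule (f : ABCRule C) : Prop :=
  ∃ h : ℕ → ℝ, IsThieleCountingFunction (Fintype.card C) h ∧
    f.IsSequentialValuationRuleOf fun S W => h (S ∩ W).card

/-- Step-dependent sequential Thiele rules. -/
def IsStepDependentSequentialThieleRule (f : ABCRule C) : Prop :=
  ∃ h : ℕ → ℕ → ℝ, IsStepDependentThieleCountingFunction (Fintype.card C) h ∧
    f.IsSequentialValuationRuleOf fun S W => h (S ∩ W).card W.card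

end ABCRule

/-! A Thiele rule extends the current committee W by a candidate of maximal `gain`: an approval on a
ballot containing t members of W is worth the increment of h at t. Gains are linear in the ballot
counts, and the axioms follow directly from this.

For the converse in (1), weights are constructed by induction on the size of W. Once the earlier
steps are governed by weights, the ballot vector `baseVec W` makes W the unique winner and treats
all candidates outside W alike. Adding a large multiple of it to any integer vector z yields a
profile in which only W wins, so the choice of the next candidate extends to a choice function
`nextVec` on the whole group of ballot vectors (`regularChoice_nextVec`). Consistency of the
generator shows that nothing is lost: `nextVec` agrees with the generator at every profile for which
W is a winner, even if not the only one (`mem_nextVec_iff`).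

For two candidates x, x' outside W, the relation `WeaklyBeats` then defines an archimedean total
preorder on ballot vectors, so by Hölder's theorem it is the nonnegativity of a real homomorphism φ.
Neutrality makes φ vanish on ballots that do not separate x from x', and together with independence
of losers it forces the value of a ballot containing x but not x' to depend only on the size of its
intersection with W. These values are the weights (`exists_weights`); permutations of the candidates
carry them to all committees of the same size and all pairs.

For (2), a candidate b approved only by a separate group of voters is elected in addition to V.
Separability then relates step k + 1 at V ∪ {b} to step k at V and preserves comparisons of integer
multiples of weights (`mul_weights_le_of_separable`). The weights of consecutive steps are therefore
proportional, and rescaling gives one sequence for all steps.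

Throughout, the coordinate of a ballot vector at the empty set carries no information. -/

open Filter

/-! ### Archimedean preorders on abelian groups -/

/-- **Hölder's theorem** for an archimedean total preorder on an abelian group that is compatible
with addition: its nonnegative elements are those on which some real-valued homomorphism is
nonnegative. -/
theorem exists_addMonoidHom_nonneg_iff {Z : Type*} [AddCommGroup Z] (P : Z → Prop)
    (zero : P 0) (add : ∀ {a b}, P a → P b → P (a + b)) (total : ∀ a, P a ∨ P (-a))
    (arch : ∀ a b, P a → ¬ P (-a) → ∃ n : ℕ, P (n • a + b)) :
    ∃ φ : Z →+ ℝ, ∀ z, P z ↔ 0 ≤ φ z := by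
  classical
  -- Modulo the elements equivalent to 0 the preorder becomes a linear order, archimedean by `arch`,
  -- and thus embeds into ℝ.
  let H : AddSubgroup Z :=
    { carrier := {z | P z ∧ P (-z)}
      zero_mem' := ⟨zero, by simpa using zero⟩
      add_mem' := fun {a b} ha hb => ⟨add ha.1 hb.1, by
        have := add ha.2 hb.2
        rwa [neg_add]⟩
      neg_mem' := fun {a} ha => ⟨ha.2, by simpa using ha.1⟩ }
  have hP : ∀ a b : Z, (QuotientAddGroup.mk a : Z ⧸ H) = QuotientAddGroup.mk b → P a → P b := by
    intro a b hab ha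
    have h : -a + b ∈ H := QuotientAddGroup.eq.1 hab
    simpa using add ha h.1
  let Q : Z ⧸ H → Prop := fun q => ∃ a, QuotientAddGroup.mk a = q ∧ P a
  have hQ : ∀ a : Z, Q (QuotientAddGroup.mk a) ↔ P a :=
    fun a => ⟨fun ⟨b, hb, h⟩ => hP b a hb h, fun h => ⟨a, rfl, h⟩⟩
  let K : AddGroupCone (Z ⧸ H) :=
    { carrier := {q | Q q}
      zero_mem' := (hQ 0).2 zero
      add_mem' := by
        rintro _ _ ⟨a, rfl, ha⟩ ⟨b, rfl, hb⟩
        exact (hQ (a + b)).2 (add ha hb)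
      eq_zero_of_mem_of_neg_mem' := by
        rintro _ ⟨a, rfl, ha⟩ h
        have h' : P (-a) := (hQ (-a)).1 h
        exact (QuotientAddGroup.eq_zero_iff a).2 ⟨ha, h'⟩ }
  have hK : ∀ a : Z, (QuotientAddGroup.mk a : Z ⧸ H) ∈ K ↔ P a := hQ
  have : HasMemOrNegMem K := ⟨fun q => by
    obtain ⟨a, rfl⟩ := QuotientAddGroup.mk_surjective q
    exact (total a).imp (hK a).2 (hK (-a)).2⟩
  let : LinearOrder (Z ⧸ H) := LinearOrder.mkOfAddGroupCone K
  have : IsOrderedAddMonoid (Z ⧸ H) := IsOrderedAddMonoid.mkOfCone K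
  have le_iff : ∀ p q : Z ⧸ H, p ≤ q ↔ q - p ∈ K := fun _ _ => Iff.rfl
  have : Archimedean (Z ⧸ H) := ⟨by
    intro p q hq
    obtain ⟨b, rfl⟩ := QuotientAddGroup.mk_surjective p
    obtain ⟨a, rfl⟩ := QuotientAddGroup.mk_surjective q
    have h1 : P a := by
      have := (le_iff _ _).1 hq.le
      rw [sub_zero] at this
      exact (hK a).1 this
    have h2 : ¬ P (-a) := by
      intro h
      refine hq.not_ge ((le_iff _ _).2 ?_)
      rw [zero_sub]
      exact (hK (-a)).2 h
    obtain ⟨n, hn⟩ := arch a (-b) h1 h2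
    refine ⟨n, (le_iff _ _).2 ?_⟩
    rw [sub_eq_add_neg]
    exact (hK (n • a + -b)).2 hn⟩
  obtain ⟨φ, hφ⟩ := Archimedean.exists_orderAddMonoidHom_real_injective (Z ⧸ H)
  refine ⟨φ.toAddMonoidHom.comp (QuotientAddGroup.mk' H), fun z => ?_⟩
  have hmono : StrictMono φ := φ.monotone'.strictMono_of_injective hφ
  have : (0 : Z ⧸ H) ≤ QuotientAddGroup.mk z ↔ P z := by
    rw [le_iff, sub_zero, hK]
  rw [← this, ← hmono.le_iff_le, map_zero]
  rfl

/-- Two colourings of a type with equinumerous colour classes differ by a permutation. -/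
theorem exists_perm_of_fiber_equiv {α κ : Type*} (c c' : α → κ)
    (h : ∀ i, Nonempty ({a // c a = i} ≃ {a // c' a = i})) :
    ∃ τ : Equiv.Perm α, ∀ a, c' (τ a) = c a := by
  let e := fun i => (h i).some
  refine ⟨(Equiv.sigmaFiberEquiv c).symm.trans
    ((Equiv.sigmaCongrRight e).trans (Equiv.sigmaFiberEquiv c')), fun a => ?_⟩
  exact ((e (c a)) ⟨a, rfl⟩).2

/-- A permutation of the candidates acts on ballot vectors. -/
def permVec {C : Type*} (τ : Equiv.Perm C) : (Finset C → ℤ) →+ (Finset C → ℤ) where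
  toFun z S := z (S.map τ.symm.toEmbedding)
  map_zero' := rfl
  map_add' _ _ := rfl

/-! ### Ballot vectors, permutations of candidates, and gains -/

section BallotVectors

variable {C : Type*}

theorem permVec_apply (τ : Equiv.Perm C) (z : Finset C → ℤ) (S : Finset C) :
    permVec τ z S = z (S.map τ.symm.toEmbedding) := rfl

theorem Finset.map_perm_map_perm (σ τ : Equiv.Perm C) (S : Finset C) :
    (S.map τ.toEmbedding).map σ.toEmbedding = S.map (σ * τ).toEmbedding := by
  rw [Finset.map_map]; rfl

theorem Finset.map_perm_one (S : Finset C) : S.map (1 : Equiv.Perm C).toEmbedding = S :=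
  Finset.map_refl

theorem Finset.map_perm_symm_map (τ : Equiv.Perm C) (S : Finset C) :
    (S.map τ.symm.toEmbedding).map τ.toEmbedding = S := by
  rw [Finset.map_map]; ext; simp

theorem Finset.map_perm_map_symm (τ : Equiv.Perm C) (S : Finset C) :
    (S.map τ.toEmbedding).map τ.symm.toEmbedding = S := by
  rw [Finset.map_map]; ext; simp

theorem permVec_mul (σ τ : Equiv.Perm C) (z : Finset C → ℤ) :
    permVec (σ * τ) z = permVec σ (permVec τ z) := by
  funext S
  rw [permVec_apply, permVec_apply, permVec_apply, Finset.map_map]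
  rfl

theorem permVec_one (z : Finset C → ℤ) : permVec 1 z = z := by
  funext S
  rw [permVec_apply]
  congr 1
  exact Finset.map_refl

theorem permVec_map (τ : Equiv.Perm C) (z : Finset C → ℤ) (S : Finset C) :
    permVec τ z (S.map τ.toEmbedding) = z S := by
  rw [permVec_apply, Finset.map_perm_map_symm]

variable [DecidableEq C]

theorem permVec_single (τ : Equiv.Perm C) (S : Finset C) (a : ℤ) :
    permVec τ (Pi.single S a) = Pi.single (S.map τ.toEmbedding) a := by
  funext T
  rw [permVec_apply]
  by_cases h : T = S.map τ.toEmbedding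
  · subst h
    rw [Finset.map_perm_map_symm]
    simp
  · have : T.map τ.symm.toEmbedding ≠ S := by
      rintro rfl
      exact h (Finset.map_perm_symm_map τ T).symm
    simp [h, this]

variable [Fintype C]

/-- The amount by which the score of `W` increases if `x` is added to it, where an approval of `x`
on a ballot that contains `t` members of `W` is worth `w t`. -/
noncomputable def gain (w : ℕ → ℝ) (z : Finset C → ℤ) (W : Finset C) (x : C) : ℝ :=
  ∑ S : Finset C, if x ∈ S then (z S : ℝ) * w (S ∩ W).card else 0

theorem gain_add (w : ℕ → ℝ) (z z' : Finset C → ℤ) (W : Finset C) (x : C) :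
    gain w (z + z') W x = gain w z W x + gain w z' W x := by
  simp only [gain, ← Finset.sum_add_distrib]
  refine Finset.sum_congr rfl fun S _ => ?_
  split_ifs
  · push_cast [Pi.add_apply]; ring
  · simp

theorem gain_zero (w : ℕ → ℝ) (W : Finset C) (x : C) : gain w 0 W x = 0 := by
  simp [gain]

theorem gain_nsmul (w : ℕ → ℝ) (n : ℕ) (z : Finset C → ℤ) (W : Finset C) (x : C) :
    gain w (n • z) W x = n * gain w z W x := by
  induction n with
  | zero => simp [gain_zero]
  | succ n ih => rw [succ_nsmul, gain_add, ih]; push_cast; ring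

theorem gain_single (w : ℕ → ℝ) (S : Finset C) (a : ℤ) (W : Finset C) (x : C) :
    gain w (Pi.single S a) W x = if x ∈ S then a * w (S ∩ W).card else 0 := by
  rw [gain, Finset.sum_eq_single S]
  · simp
  · intro T _ hT
    simp [hT]
  · simp

theorem gain_congr (w : ℕ → ℝ) {z z' : Finset C → ℤ} (W : Finset C) (x : C)
    (h : ∀ S : Finset C, S.Nonempty → z S = z' S) : gain w z W x = gain w z' W x := by
  refine Finset.sum_congr rfl fun S _ => ?_
  split_ifs with hx
  · rw [h S ⟨x, hx⟩]
  · rfl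

theorem gain_permVec (w : ℕ → ℝ) (τ : Equiv.Perm C) (z : Finset C → ℤ) (W : Finset C) (x : C) :
    gain w (permVec τ z) (W.map τ.toEmbedding) (τ x) = gain w z W x := by
  symm
  refine Fintype.sum_equiv τ.finsetCongr _ _ fun S => ?_
  rw [Equiv.finsetCongr_apply, permVec_map, ← Finset.map_inter, Finset.card_map]
  simp

end BallotVectors

/-! ### Consistent choice functions on ballot vectors -/

section Choice

variable {C : Type*}

/-- A choice function on ballot vectors that selects nonempty sets of candidates outside `W`, is
consistent, continuous and neutral, and respects the independence of losers. -/
structure RegularChoice [DecidableEq C] (W : Finset C) (G : (Finset C → ℤ) → Set C) : Prop where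
  notMem : ∀ {z x}, x ∈ G z → x ∉ W
  nonempty : ∀ z, (G z).Nonempty
  zero : ∀ {x}, x ∉ W → x ∈ G 0
  add : ∀ {z z' y}, y ∈ G z → y ∈ G z' → G (z + z') = G z ∩ G z'
  continuous : ∀ {a x}, G a = {x} → ∀ z, ∃ n : ℕ, 1 ≤ n ∧ G (n • a + z) = {x}
  neutral : ∀ {τ : Equiv.Perm C}, W.map τ.toEmbedding = W → ∀ {z x},
    x ∈ G z → τ x ∈ G (permVec τ z)
  -- One voter replaces S by S \ R; the result must be nonempty to be a ballot.
  losers : ∀ {z x} {S R : Finset C}, x ∈ G z → x ∉ R → Disjoint R W → (S \ R).Nonempty →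
    x ∈ G (z + (Pi.single (S \ R) 1 - Pi.single S 1))

theorem Finset.map_swap_of_notMem [DecidableEq C] {S : Finset C} {x y : C} (hx : x ∉ S)
    (hy : y ∉ S) : S.map (Equiv.swap x y).toEmbedding = S := by
  ext a
  rw [Finset.mem_map_equiv, Equiv.symm_swap]
  by_cases hax : a = x
  · subst hax; simp [hx, hy]
  by_cases hay : a = y
  · subst hay; simp [hx, hy]
  rw [Equiv.swap_apply_of_ne_of_ne hax hay]

theorem Finset.map_swap_of_mem [DecidableEq C] {S : Finset C} {x y : C} (hx : x ∈ S)
    (hy : y ∈ S) : S.map (Equiv.swap x y).toEmbedding = S := by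
  ext a
  rw [Finset.mem_map_equiv, Equiv.symm_swap]
  by_cases hax : a = x
  · subst hax; simp [hx, hy]
  by_cases hay : a = y
  · subst hay; simp [hx, hy]
  rw [Equiv.swap_apply_of_ne_of_ne hax hay]

namespace RegularChoice

variable [DecidableEq C] {W : Finset C} {G : (Finset C → ℤ) → Set C}

theorem nsmul (hG : RegularChoice W G) (z : Finset C → ℤ) {n : ℕ} (hn : 1 ≤ n) :
    G (n • z) = G z := by
  obtain ⟨y, hy⟩ := hG.nonempty z
  induction n, hn using Nat.le_induction with
  | base => rw [one_smul]
  | succ n hn ih => rw [succ_nsmul, hG.add (ih ▸ hy) hy, ih, Set.inter_self]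

theorem mem_add (hG : RegularChoice W G) {z z' : Finset C → ℤ} {y : C} (h : y ∈ G z)
    (h' : y ∈ G z') : y ∈ G (z + z') := by
  rw [hG.add h h']; exact ⟨h, h'⟩

theorem eq_of_mem_of_singleton (hG : RegularChoice W G) {z z' : Finset C → ℤ} {y x : C}
    (h : G z = {y}) (h' : y ∈ G z') (hx : x ∈ G (z + z')) : x = y := by
  rw [hG.add (h ▸ rfl) h', h] at hx
  exact hx.1

theorem sum_eq_singleton (hG : RegularChoice W G) {ι : Type*} (s : Finset ι) (hs : s.Nonempty)
    (z : ι → Finset C → ℤ) {y : C} (h : ∀ i ∈ s, G (z i) = {y}) : G (∑ i ∈ s, z i) = {y} := by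
  classical
  induction hs using Finset.Nonempty.cons_induction with
  | singleton a => simpa using h
  | cons a s ha hs ih =>
    have h1 := h a (by simp)
    have h2 := ih fun i hi => h i (by simp [hi])
    rw [Finset.sum_cons, hG.add (y := y) (by rw [h1]; rfl) (by rw [h2]; rfl), h1, h2,
      Set.inter_self]

theorem mem_permVec_iff (hG : RegularChoice W G) {τ : Equiv.Perm C}
    (hτ : W.map τ.toEmbedding = W) {z : Finset C → ℤ} {x : C} :
    τ x ∈ G (permVec τ z) ↔ x ∈ G z := by
  refine ⟨fun h => ?_, hG.neutral hτ⟩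
  have h1 : W.map (τ⁻¹).toEmbedding = W := by
    conv_lhs => rw [← hτ]
    exact Finset.map_perm_map_symm τ W
  have := hG.neutral h1 h
  rw [← permVec_mul, inv_mul_cancel, permVec_one] at this
  rwa [← τ.symm_apply_apply x]

/-- A symmetrised ballot vector by which `y` is chosen, and which makes `y` the only loser when
it is negated. -/
theorem exists_singleton_neg [Fintype C] (hG : RegularChoice W G) {a : Finset C → ℤ} {y : C}
    (ha : G a = {y}) (hW : ∃ x, x ∉ W ∧ x ≠ y) :
    ∃ b, G b = {y} ∧ ∀ x, x ∈ G (-b) ↔ x ∉ W ∧ x ≠ y := by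
  classical
  -- Averaging over the stabiliser of W and y keeps y the unique choice and makes the vector
  -- invariant under swaps of the other candidates outside W.
  let H : Finset (Equiv.Perm C) :=
    Finset.univ.filter fun τ => W.map τ.toEmbedding = W ∧ τ y = y
  have hy : y ∉ W := hG.notMem (z := a) (by rw [ha]; rfl)
  have hb : G (∑ τ ∈ H, permVec τ a) = {y} := by
    refine hG.sum_eq_singleton H ⟨1, ?_⟩ _ fun τ hτ => ?_
    · simp only [H, Finset.mem_filter, Finset.mem_univ, true_and]
      exact ⟨Finset.map_perm_one W, rfl⟩
    · obtain ⟨h1, h2⟩ := (Finset.mem_filter.1 hτ).2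
      ext x
      rw [← τ.apply_symm_apply x, hG.mem_permVec_iff h1, ha, Set.mem_singleton_iff,
        Set.mem_singleton_iff]
      nth_rewrite 2 [← h2]
      exact τ.injective.eq_iff.symm
  have hinv : ∀ σ ∈ H, permVec σ (∑ τ ∈ H, permVec τ a) = ∑ τ ∈ H, permVec τ a := by
    intro σ hσ
    rw [map_sum]
    refine Finset.sum_equiv (Equiv.mulLeft σ) (fun τ => ?_) fun τ _ => ?_
    · obtain ⟨h1, h2⟩ := (Finset.mem_filter.1 hσ).2
      simp only [H, Finset.mem_filter, Finset.mem_univ, true_and, Equiv.coe_mulLeft,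
        Equiv.Perm.mul_apply]
      rw [← Finset.map_perm_map_perm]
      constructor
      · rintro ⟨h3, h4⟩
        exact ⟨by rw [h3, h1], by rw [h4, h2]⟩
      · rintro ⟨h3, h4⟩
        refine ⟨?_, σ.injective (by rw [h4, h2])⟩
        exact Finset.map_injective σ.toEmbedding (h3.trans h1.symm)
    · rw [← permVec_mul]; rfl
  refine ⟨_, hb, fun x => ⟨fun hx => ⟨hG.notMem hx, ?_⟩, ?_⟩⟩
  · rintro rfl
    obtain ⟨x', h1, h2⟩ := hW
    refine h2 (hG.eq_of_mem_of_singleton hb hx ?_)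
    rw [add_neg_cancel]
    exact hG.zero h1
  · rintro ⟨h1, h2⟩
    -- Some candidate is chosen at the negated vector, and it is not y, since otherwise only y would
    -- be chosen at 0. Invariance under swaps then gives all the others.
    obtain ⟨x', hx'⟩ := hG.nonempty (-∑ τ ∈ H, permVec τ a)
    have hx'W := hG.notMem hx'
    have hx'y : x' ≠ y := by
      rintro rfl
      refine h2 (hG.eq_of_mem_of_singleton hb hx' ?_)
      rw [add_neg_cancel]
      exact hG.zero h1
    have hs : W.map (Equiv.swap x x').toEmbedding = W := Finset.map_swap_of_notMem h1 hx'W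
    have hm : Equiv.swap x x' ∈ H := by
      simp only [H, Finset.mem_filter, Finset.mem_univ, true_and]
      exact ⟨hs, Equiv.swap_apply_of_ne_of_ne h2.symm hx'y.symm⟩
    have := hG.neutral hs hx'
    rwa [Equiv.swap_apply_right, map_neg, hinv _ hm] at this

/-- Arbitrary ballot vectors can be shifted such that only `x` and `x'` can be chosen. -/
theorem exists_pair [Fintype C] (hG : RegularChoice W G)
    (hs : ∀ y, y ∉ W → ∃ a, G a = {y}) {x x' : C} (hx : x ∉ W) (hx' : x' ∉ W)
    (z : Finset C → ℤ) :
    ∃ q, (∀ y, y ∈ G q ↔ y = x ∨ y = x') ∧ ∀ y ∈ G (z + q), y = x ∨ y = x' := by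
  classical
  let Y : Finset C := Finset.univ.filter fun y => y ∉ W ∧ y ≠ x ∧ y ≠ x'
  -- Adding -c y excludes y without affecting the rest, and by continuity c y is taken so large a
  -- multiple that it overrules -z. The sum of all -c y is the required q.
  have key : ∀ y, ∃ c : Finset C → ℤ, y ∈ Y → G (c - z) = {y} ∧
      ∀ u, u ∈ G (-c) ↔ u ∉ W ∧ u ≠ y := by
    intro y
    by_cases hy : y ∈ Y
    · obtain ⟨h1, h2, h3⟩ := (Finset.mem_filter.1 hy).2
      obtain ⟨a, ha⟩ := hs y h1
      obtain ⟨b, hb, hb'⟩ := hG.exists_singleton_neg ha ⟨x, hx, h2.symm⟩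
      obtain ⟨n, hn, hn'⟩ := hG.continuous hb (-z)
      refine ⟨n • b, fun _ => ⟨by rw [sub_eq_add_neg]; exact hn', fun u => ?_⟩⟩
      rw [← smul_neg, hG.nsmul _ hn, hb']
    · exact ⟨0, fun h => absurd h hy⟩
  choose c hc using key
  have hsum : ∀ T ⊆ Y, ∀ u, u ∈ G (∑ y ∈ T, -c y) ↔ u ∉ W ∧ u ∉ T := by
    intro T
    induction T using Finset.induction_on with
    | empty =>
      intro _ u
      simp only [Finset.sum_empty, Finset.notMem_empty, not_false_eq_true, and_true]
      exact ⟨hG.notMem, hG.zero⟩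
    | insert y T hy ih =>
      intro hT u
      have hyY := hT (Finset.mem_insert_self y T)
      have hTY : T ⊆ Y := (Finset.subset_insert y T).trans hT
      have hxT : ∀ T' ⊆ Y, x ∉ T' := fun T' h h' => (Finset.mem_filter.1 (h h')).2.2.1 rfl
      rw [Finset.sum_insert hy, hG.add (y := x) (((hc y hyY).2 x).2 ⟨hx, ?_⟩)
        ((ih hTY x).2 ⟨hx, hxT T hTY⟩), Set.mem_inter_iff, (hc y hyY).2, ih hTY,
        Finset.mem_insert]
      · tauto
      · rintro rfl
        exact hxT _ hT (Finset.mem_insert_self _ _)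
  have hY : ∀ u, u ∉ W ∧ u ∉ Y ↔ u = x ∨ u = x' := by
    intro u
    simp only [Y, Finset.mem_filter, Finset.mem_univ, true_and]
    constructor
    · rintro ⟨h1, h2⟩
      by_contra h
      push Not at h
      exact h2 ⟨h1, h⟩
    · rintro (rfl | rfl)
      · exact ⟨hx, fun h => h.2.1 rfl⟩
      · exact ⟨hx', fun h => h.2.2 rfl⟩
  refine ⟨∑ y ∈ Y, -c y, fun y => (hsum Y le_rfl y).trans (hY y), fun y hy => ?_⟩
  rw [← hY]
  refine ⟨hG.notMem hy, fun hyY => ?_⟩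
  have hxy : x ≠ y := (Finset.mem_filter.1 hyY).2.2.1.symm
  refine hxy (hG.eq_of_mem_of_singleton (hc y hyY).1 hy ?_)
  -- If y were chosen at z + q, adding c y - z would leave y as the only choice. The sum no longer
  -- contains the term that excludes y, but x is still chosen there.
  have : c y - z + (z + ∑ y ∈ Y, -c y) = ∑ y ∈ Y.erase y, -c y := by
    rw [← Finset.add_sum_erase Y _ hyY]; abel
  rw [this, hsum _ (Finset.erase_subset y Y)]
  refine ⟨hx, fun h => ?_⟩
  exact (Finset.mem_filter.1 (Finset.mem_of_mem_erase h)).2.2.1 rfl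

end RegularChoice

/-- `x` is at least as good as `x'` in some situation where both are chosen otherwise. -/
def WeaklyBeats (G : (Finset C → ℤ) → Set C) (x x' : C) (z : Finset C → ℤ) : Prop :=
  ∃ q, x ∈ G q ∧ x' ∈ G q ∧ x ∈ G (z + q)

namespace RegularChoice

variable [DecidableEq C] {W : Finset C} {G : (Finset C → ℤ) → Set C}

/-- If y is chosen at z and x weakly beats y by means of q, then y is chosen at z and at q, so
consistency puts the choice at z + q inside the choice at z. Pairwise comparisons therefore
determine the choice. -/
theorem mem_iff_weaklyBeats (hG : RegularChoice W G) {x : C} (hx : x ∉ W) {z : Finset C → ℤ} :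
    x ∈ G z ↔ ∀ x', x' ∉ W → x' ≠ x → WeaklyBeats G x x' z := by
  constructor
  · exact fun h x' hx' _ => ⟨0, hG.zero hx, hG.zero hx', by rwa [add_zero]⟩
  · intro h
    obtain ⟨y, hy⟩ := hG.nonempty z
    by_cases hyx : y = x
    · rwa [← hyx]
    obtain ⟨q, h1, h2, h3⟩ := h y (hG.notMem hy) hyx
    rw [hG.add hy h2] at h3
    exact h3.1

theorem weaklyBeats_zero (hG : RegularChoice W G) {x x' : C} (hx : x ∉ W) (hx' : x' ∉ W) :
    WeaklyBeats G x x' 0 :=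
  ⟨0, hG.zero hx, hG.zero hx', by rw [add_zero]; exact hG.zero hx⟩

theorem weaklyBeats_add (hG : RegularChoice W G) {x x' : C} {z z' : Finset C → ℤ}
    (h : WeaklyBeats G x x' z) (h' : WeaklyBeats G x x' z') : WeaklyBeats G x x' (z + z') := by
  obtain ⟨q, h1, h2, h3⟩ := h
  obtain ⟨q', h1', h2', h3'⟩ := h'
  refine ⟨q + q', hG.mem_add h1 h1', hG.mem_add h2 h2', ?_⟩
  rw [add_add_add_comm]
  exact hG.mem_add h3 h3'

/-- Shift z and -z so that only x and x' can be chosen. If x failed in both, x' would be chosen in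
both, and by consistency x would not be chosen at the sum of the two vectors. But this sum is that
of the two shifts, at both of which x is chosen. -/
theorem weaklyBeats_total [Fintype C] (hG : RegularChoice W G)
    (hs : ∀ y, y ∉ W → ∃ a, G a = {y}) {x x' : C} (hx : x ∉ W) (hx' : x' ∉ W)
    (z : Finset C → ℤ) : WeaklyBeats G x x' z ∨ WeaklyBeats G x x' (-z) := by
  obtain ⟨q, hq, hq'⟩ := hG.exists_pair hs hx hx' z
  obtain ⟨r, hr, hr'⟩ := hG.exists_pair hs hx hx' (-z)
  by_cases h : x ∈ G (z + q)
  · exact Or.inl ⟨q, (hq x).2 (Or.inl rfl), (hq x').2 (Or.inr rfl), h⟩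
  by_cases h' : x ∈ G (-z + r)
  · exact Or.inr ⟨r, (hr x).2 (Or.inl rfl), (hr x').2 (Or.inr rfl), h'⟩
  exfalso
  have aux : ∀ v, (∀ y ∈ G v, y = x ∨ y = x') → x ∉ G v → x' ∈ G v := by
    intro v hv hxv
    obtain ⟨y, hy⟩ := hG.nonempty v
    rcases hv y hy with rfl | rfl
    exacts [absurd hy hxv, hy]
  have h1 := hG.add (aux _ hq' h) (aux _ hr' h')
  have h2 : x ∈ G (q + r) := hG.mem_add ((hq x).2 (Or.inl rfl)) ((hr x).2 (Or.inl rfl))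
  rw [show z + q + (-z + r) = q + r by abel] at h1
  rw [h1] at h2
  exact h h2.1

/-- A strict comparison becomes a unique choice of x after a shift that leaves only x and x'
eligible; continuity then overrules v. -/
theorem weaklyBeats_archimedean [Fintype C] (hG : RegularChoice W G)
    (hs : ∀ y, y ∉ W → ∃ a, G a = {y}) {x x' : C} (hx : x ∉ W) (hx' : x' ∉ W)
    (z v : Finset C → ℤ) (h : WeaklyBeats G x x' z) (h' : ¬ WeaklyBeats G x x' (-z)) :
    ∃ n : ℕ, WeaklyBeats G x x' (n • z + v) := by
  obtain ⟨q, hq, hq'⟩ := hG.exists_pair hs hx hx' z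
  have hxq := (hq x).2 (Or.inl rfl)
  have hxq' := (hq x').2 (Or.inr rfl)
  have hx1 : x ∈ G (z + q) := by
    obtain ⟨y, hy⟩ := hG.nonempty (z + q)
    rcases hq' y hy with rfl | rfl
    · exact hy
    · obtain ⟨r, h1, h2, h3⟩ := h
      have h4 := hG.mem_add h3 hxq
      rw [show z + r + q = z + q + r by abel, hG.add hy h2] at h4
      exact h4.1
  have hx2 : x' ∉ G (z + q) := fun hx2 => h' ⟨z + q, hx1, hx2, by rwa [neg_add_cancel_left]⟩
  have h1 : G (z + q) = {x} := by
    ext y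
    rw [Set.mem_singleton_iff]
    refine ⟨fun hy => ?_, fun hy => hy ▸ hx1⟩
    rcases hq' y hy with rfl | rfl
    exacts [rfl, absurd hy hx2]
  obtain ⟨n, hn, hn'⟩ := hG.continuous h1 v
  refine ⟨n, n • q, ?_, ?_, ?_⟩
  · rwa [hG.nsmul q hn]
  · rwa [hG.nsmul q hn]
  · rw [show n • z + v + n • q = n • (z + q) + v by rw [smul_add]; abel, hn']
    rfl

theorem weaklyBeats_permVec (hG : RegularChoice W G) {τ : Equiv.Perm C}
    (hτ : W.map τ.toEmbedding = W) {x x' : C} {z : Finset C → ℤ}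
    (h : WeaklyBeats G x x' z) : WeaklyBeats G (τ x) (τ x') (permVec τ z) := by
  obtain ⟨q, h1, h2, h3⟩ := h
  refine ⟨permVec τ q, hG.neutral hτ h1, hG.neutral hτ h2, ?_⟩
  rw [← map_add]
  exact hG.neutral hτ h3

/-- The comparison of two fixed candidates is governed by a homomorphism. -/
theorem exists_hom [Fintype C] (hG : RegularChoice W G)
    (hs : ∀ y, y ∉ W → ∃ a, G a = {y}) {x x' : C} (hx : x ∉ W) (hx' : x' ∉ W) :
    ∃ φ : (Finset C → ℤ) →+ ℝ, ∀ z, WeaklyBeats G x x' z ↔ 0 ≤ φ z :=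
  exists_addMonoidHom_nonneg_iff _ (hG.weaklyBeats_zero hx hx') hG.weaklyBeats_add
    (hG.weaklyBeats_total hs hx hx') (hG.weaklyBeats_archimedean hs hx hx')

end RegularChoice

end Choice

/-! ### Weights from symmetry -/

section Representation

variable {C : Type*} [Fintype C] [DecidableEq C]

theorem exists_perm_map_eq {W W' : Finset C} (h : W.card = W'.card) :
    ∃ σ : Equiv.Perm C, W.map σ.toEmbedding = W' := by
  obtain ⟨σ, hσ⟩ := exists_perm_of_fiber_equiv (fun a => decide (a ∈ W))
    (fun a => decide (a ∈ W')) (by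
      rintro (_ | _)
      · have : (Wᶜ).card = (W'ᶜ).card := by rw [Finset.card_compl, Finset.card_compl, h]
        have e := Finset.equivOfCardEq this
        exact ⟨((Equiv.subtypeEquivRight (by simp)).trans e).trans
          (Equiv.subtypeEquivRight (by simp))⟩
      · have e := Finset.equivOfCardEq h
        exact ⟨((Equiv.subtypeEquivRight (by simp)).trans e).trans
          (Equiv.subtypeEquivRight (by simp))⟩)
  refine ⟨σ, ?_⟩
  ext a
  have := hσ (σ.symm a)
  rw [Equiv.apply_symm_apply] at this
  rw [Finset.mem_map_equiv]
  simpa using this.symm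

omit [Fintype C] in
theorem exists_perm_map_subset {W T T' : Finset C} (hT : T ⊆ W) (hT' : T' ⊆ W)
    (h : T.card = T'.card) :
    ∃ τ : Equiv.Perm C, W.map τ.toEmbedding = W ∧ T.map τ.toEmbedding = T' ∧
      ∀ a, a ∉ W → τ a = a := by
  -- Every candidate outside W has a colour of its own, so a colour-preserving permutation fixes it;
  -- inside W only membership in the subset is recorded.
  let c : Finset C → C → C ⊕ Bool := fun U a => if a ∈ W then Sum.inr (decide (a ∈ U)) else
    Sum.inl a
  have hc : ∀ U b a, c U a = Sum.inr b ↔ a ∈ W ∧ decide (a ∈ U) = b := by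
    intro U b a
    by_cases ha : a ∈ W <;> simp [c, ha]
  have hc' : ∀ U b a, c U a = Sum.inl b ↔ a ∉ W ∧ a = b := by
    intro U b a
    by_cases ha : a ∈ W <;> simp [c, ha]
  obtain ⟨τ, hτ⟩ := exists_perm_of_fiber_equiv (c T) (c T') (by
    rintro (b | _ | _)
    · exact ⟨Equiv.subtypeEquivRight fun a => by rw [hc', hc']⟩
    · have : (W \ T).card = (W \ T').card := by
        rw [Finset.card_sdiff_of_subset hT, Finset.card_sdiff_of_subset hT', h]
      have e := Finset.equivOfCardEq this
      exact ⟨((Equiv.subtypeEquivRight (by simp [hc])).trans e).trans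
          (Equiv.subtypeEquivRight (by simp [hc]))⟩
    · have e := Finset.equivOfCardEq h
      exact ⟨((Equiv.subtypeEquivRight (by
          intro a; rw [hc]; simpa using fun h => hT h)).trans e).trans
          (Equiv.subtypeEquivRight (by
          intro a; rw [hc]; simpa using fun h => hT' h))⟩)
  have hW : ∀ a, τ a ∈ W ↔ a ∈ W := by
    intro a
    by_cases h1 : a ∈ W
    · have h2 := (hτ a).trans ((hc T _ a).2 ⟨h1, rfl⟩)
      exact iff_of_true ((hc T' _ (τ a)).1 h2).1 h1
    · have h2 := (hτ a).trans ((hc' T a a).2 ⟨h1, rfl⟩)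
      exact iff_of_false ((hc' T' _ (τ a)).1 h2).1 h1
  refine ⟨τ, ?_, ?_, fun a ha => ?_⟩
  · ext a
    rw [Finset.mem_map_equiv, ← hW, Equiv.apply_symm_apply]
  · ext a
    have := hτ (τ.symm a)
    have h3 := hW (τ.symm a)
    rw [Equiv.apply_symm_apply] at this h3
    rw [Finset.mem_map_equiv]
    by_cases h1 : a ∈ W
    · have h2 := h3.1 h1
      simpa [c, h1, h2] using this.symm
    · exact ⟨fun h => absurd (h3.2 (hT h)) h1, fun h => absurd (hT' h) h1⟩
  · have h1 := hτ a
    rw [(hc' T a a).2 ⟨ha, rfl⟩, hc'] at h1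
    exact h1.2

/-- The symmetric group acts transitively on triples of a set of given size and two distinct
candidates outside of it. -/
theorem exists_perm_map_eq_apply_eq {W W' : Finset C} (h : W.card = W'.card) {x y x' y' : C}
    (hx : x ∉ W) (hy : y ∉ W) (hxy : x ≠ y) (hx' : x' ∉ W') (hy' : y' ∉ W') (hxy' : x' ≠ y') :
    ∃ τ : Equiv.Perm C, W.map τ.toEmbedding = W' ∧ τ x = x' ∧ τ y = y' := by
  obtain ⟨σ, hσ⟩ := exists_perm_map_eq h
  have hmem : ∀ (ρ : Equiv.Perm C), W.map ρ.toEmbedding = W' → ∀ a, a ∉ W → ρ a ∉ W' := by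
    intro ρ hρ a ha
    rw [← hρ]
    simpa using ha
  let σ₁ := Equiv.swap (σ x) x' * σ
  have h1 : W.map σ₁.toEmbedding = W' := by
    rw [← Finset.map_perm_map_perm, hσ]
    exact Finset.map_swap_of_notMem (hmem σ hσ x hx) hx'
  have h2 : σ₁ x = x' := by simp [σ₁]
  refine ⟨Equiv.swap (σ₁ y) y' * σ₁, ?_, ?_, by simp⟩
  · rw [← Finset.map_perm_map_perm, h1]
    exact Finset.map_swap_of_notMem (hmem σ₁ h1 y hy) hy'
  · rw [Equiv.Perm.mul_apply, h2]
    refine Equiv.swap_apply_of_ne_of_ne ?_ hxy'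
    rw [← h2]
    exact fun h => hxy (σ₁.injective h)

theorem eq_sum_single_ballot (z : Finset C → ℤ) : z = ∑ S, z S • Pi.single S (1 : ℤ) := by
  funext T
  rw [Finset.sum_apply, Finset.sum_eq_single T]
  · simp
  · intro S _ hS
    simp [Ne.symm hS]
  · simp

namespace RegularChoice

variable {W : Finset C} {G : (Finset C → ℤ) → Set C}

/-- Links the comparison of x' with x to that of x with x': if each weakly beats the other at z,
then a homomorphism governing one comparison vanishes at z. -/
theorem weaklyBeats_neg (hG : RegularChoice W G)
    (hs : ∀ y, y ∉ W → ∃ a, G a = {y}) {x x' : C} (hx : x ∉ W) (hx' : x' ∉ W)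
    {z : Finset C → ℤ} (h : WeaklyBeats G x' x z) : WeaklyBeats G x x' (-z) := by
  obtain ⟨q, h1, h2, h3⟩ := h
  obtain ⟨r, hr, hr'⟩ := hG.exists_pair hs hx hx' (-z)
  by_cases h : x ∈ G (-z + r)
  · exact ⟨r, (hr x).2 (Or.inl rfl), (hr x').2 (Or.inr rfl), h⟩
  exfalso
  obtain ⟨y, hy⟩ := hG.nonempty (-z + r)
  rcases hr' y hy with rfl | rfl
  · exact h hy
  have h4 : x ∈ G (q + r) := hG.mem_add h2 ((hr x).2 (Or.inl rfl))
  rw [show q + r = z + q + (-z + r) by abel, hG.add h3 hy] at h4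
  exact h h4.2

/-- A homomorphism that governs the comparison of two candidates is invariant under the
permutations that preserve the situation. -/
theorem hom_permVec (hG : RegularChoice W G) {x x' : C} {φ : (Finset C → ℤ) →+ ℝ}
    (hφ : ∀ z, WeaklyBeats G x x' z ↔ 0 ≤ φ z) {τ : Equiv.Perm C}
    (hτ : W.map τ.toEmbedding = W) (hx : τ x = x) (hx' : τ x' = x') (z : Finset C → ℤ) :
    φ (permVec τ z) = φ z := by
  have pos : ∀ z, 0 ≤ φ z → 0 ≤ φ (permVec τ z) := by
    intro z hz
    have := hG.weaklyBeats_permVec hτ ((hφ z).2 hz)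
    rwa [hx, hx', hφ] at this
  -- The increments of φ along the orbit of z under τ are all nonnegative once the first one is.
  -- They telescope to 0 over the order of τ, so each of them vanishes.
  have key : ∀ z, 0 ≤ φ (permVec τ z - z) → φ (permVec τ z - z) = 0 := by
    intro z hz
    have h1 : ∀ i : ℕ, 0 ≤ φ (permVec (τ ^ i) (permVec τ z - z)) := by
      intro i
      induction i with
      | zero => rw [pow_zero, permVec_one]; exact hz
      | succ i ih => rw [pow_succ', permVec_mul]; exact pos _ ih
    have h2 : ∑ i ∈ Finset.range (orderOf τ), φ (permVec (τ ^ i) (permVec τ z - z)) = 0 := by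
      have : ∀ i : ℕ, φ (permVec (τ ^ i) (permVec τ z - z))
          = φ (permVec (τ ^ (i + 1)) z) - φ (permVec (τ ^ i) z) := by
        intro i
        rw [map_sub, map_sub, ← permVec_mul, ← pow_succ]
      simp only [this]
      rw [Finset.sum_range_sub fun i => φ (permVec (τ ^ i) z), pow_orderOf_eq_one, pow_zero, sub_self]
    have h3 := (Finset.sum_eq_zero_iff_of_nonneg fun i _ => h1 i).1 h2 0
      (Finset.mem_range.2 (orderOf_pos τ))
    rwa [pow_zero, permVec_one] at h3
  rcases le_total 0 (φ (permVec τ z - z)) with h | h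
  · have := key z h
    rwa [map_sub, sub_eq_zero] at this
  · have h' : 0 ≤ φ (permVec τ (-z) - -z) := by
      rw [map_neg, ← neg_sub', map_neg]
      linarith
    have := key (-z) h'
    rw [map_neg, ← neg_sub', map_neg, neg_eq_zero, map_sub, sub_eq_zero] at this
    exact this

/-- The comparison of two candidates is governed by weights. -/
theorem exists_weights (hG : RegularChoice W G) (hs : ∀ y, y ∉ W → ∃ a, G a = {y}) {x x' : C}
    (hx : x ∉ W) (hx' : x' ∉ W) (hne : x ≠ x') :
    ∃ w : ℕ → ℝ, (∀ t, 0 ≤ w t) ∧ (∃ t ≤ W.card, 0 < w t) ∧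
      ∀ z, WeaklyBeats G x x' z ↔ gain w z W x' ≤ gain w z W x := by
  obtain ⟨φ, hφ⟩ := hG.exists_hom hs hx hx'
  have hzero : ∀ z, WeaklyBeats G x x' z → WeaklyBeats G x' x z → φ z = 0 := by
    intro z h1 h2
    have h3 := (hφ _).1 (hG.weaklyBeats_neg hs hx hx' h2)
    rw [map_neg] at h3
    have := (hφ z).1 h1
    linarith
  have hswapW : W.map (Equiv.swap x x').toEmbedding = W := Finset.map_swap_of_notMem hx hx'
  -- A swap-invariant vector cannot distinguish x from x', so each weakly beats the other.
  have hswap : ∀ z, permVec (Equiv.swap x x') z = z → φ z = 0 := by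
    intro z hz
    have aux : ∀ v, permVec (Equiv.swap x x') v = v → 0 ≤ φ v → φ v = 0 := by
      intro v hv h
      refine hzero v ((hφ v).2 h) ?_
      have := hG.weaklyBeats_permVec hswapW ((hφ v).2 h)
      rwa [Equiv.swap_apply_left, Equiv.swap_apply_right, hv] at this
    rcases le_total 0 (φ z) with h | h
    · exact aux z hz h
    · have := aux (-z) (by rw [map_neg, hz]) (by rw [map_neg]; linarith)
      rwa [map_neg, neg_eq_zero] at this
  have hlos : ∀ S R : Finset C, x ∉ R → Disjoint R W → (S \ R).Nonempty →
      0 ≤ φ (Pi.single (S \ R) 1 - Pi.single S 1) := by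
    intro S R h1 h2 h3
    rw [← hφ]
    have := hG.losers (hG.zero hx) h1 h2 h3
    exact ⟨0, hG.zero hx, hG.zero hx', by rwa [add_zero, ← zero_add (_ - _)]⟩
  -- Deleting candidates other than x and x' harms neither of them, hence leaves φ unchanged.
  have hlos' : ∀ S R : Finset C, x ∉ R → x' ∉ R → Disjoint R W → (S \ R).Nonempty →
      φ (Pi.single (S \ R) 1) = φ (Pi.single S 1) := by
    intro S R h1 h1' h2 h3
    rw [← sub_eq_zero, ← map_sub]
    refine hzero _ ((hφ _).2 (hlos S R h1 h2 h3)) ?_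
    have := hG.losers (hG.zero hx') h1' h2 h3
    exact ⟨0, hG.zero hx', hG.zero hx, by rwa [add_zero, ← zero_add (_ - _)]⟩
  have hboth : ∀ S : Finset C, (x ∈ S ↔ x' ∈ S) → φ (Pi.single S 1) = 0 := by
    intro S hS
    refine hswap _ ?_
    rw [permVec_single]
    by_cases h : x ∈ S
    · rw [Finset.map_swap_of_mem h (hS.1 h)]
    · rw [Finset.map_swap_of_notMem h (mt hS.2 h)]
  have hT : ∀ t, ∃ T : Finset C, t ≤ W.card → T ⊆ W ∧ T.card = t := by
    intro t
    by_cases ht : t ≤ W.card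
    · obtain ⟨T, h⟩ := Finset.exists_subset_card_eq ht
      exact ⟨T, fun _ => h⟩
    · exact ⟨∅, fun h => absurd h ht⟩
  choose T hT using hT
  let w : ℕ → ℝ := fun t => if t ≤ W.card then φ (Pi.single (insert x (T t)) 1) else 0
  -- First delete everything outside W ∪ {x} from the ballot, then permute W so that S ∩ W becomes
  -- the fixed subset of its size.
  have hx1 : ∀ S : Finset C, x ∈ S → x' ∉ S → φ (Pi.single S 1) = w (S ∩ W).card := by
    intro S h1 h2
    have hcard : (S ∩ W).card ≤ W.card := Finset.card_le_card Finset.inter_subset_right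
    obtain ⟨h3, h4⟩ := hT _ hcard
    obtain ⟨τ, hτ1, hτ2, hτ3⟩ := exists_perm_map_subset (Finset.inter_subset_right (s₁ := S)) h3
      h4.symm
    have h5 : S \ (S \ insert x W) = insert x (S ∩ W) := by
      rw [sdiff_sdiff_right_self, Finset.inf_eq_inter, Finset.inter_insert_of_mem h1]
    rw [← hlos' S (S \ insert x W) (by simp) (by simp [h2]) ?_ (by rw [h5]; simp), h5,
      ← hG.hom_permVec hφ hτ1 (hτ3 x hx) (hτ3 x' hx'), permVec_single, Finset.map_insert, hτ2]
    · simp only [w, hcard, if_true]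
      have h6 : τ.toEmbedding x = x := hτ3 x hx
      rw [h6]
    · exact (Finset.sdiff_disjoint).mono_right (Finset.subset_insert x W)
  have hx2 : ∀ S : Finset C, x ∉ S → x' ∈ S → φ (Pi.single S 1) = -w (S ∩ W).card := by
    intro S h1 h2
    have h3 := hx1 (S.map (Equiv.swap x x').toEmbedding) (by simpa [Finset.mem_map_equiv] using h2)
      (by simpa [Finset.mem_map_equiv] using h1)
    have h4 : (S.map (Equiv.swap x x').toEmbedding ∩ W).card = (S ∩ W).card := by
      nth_rewrite 1 [← hswapW]
      rw [← Finset.map_inter, Finset.card_map]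
    have h5 := hswap (Pi.single S 1 + Pi.single (S.map (Equiv.swap x x').toEmbedding) 1) (by
      rw [map_add, permVec_single, permVec_single, Finset.map_perm_map_perm, Equiv.swap_mul_self,
        Finset.map_perm_one, add_comm])
    rw [map_add, h3, h4] at h5
    linarith
  have hform : ∀ z, φ z = gain w z W x - gain w z W x' := by
    intro z
    conv_lhs => rw [eq_sum_single_ballot z]
    rw [map_sum, gain, gain, ← Finset.sum_sub_distrib]
    refine Finset.sum_congr rfl fun S _ => ?_
    rw [map_zsmul, zsmul_eq_mul]
    by_cases h1 : x ∈ S <;> by_cases h2 : x' ∈ S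
    · rw [hboth S (by simp [h1, h2])]; simp [h1, h2]
    · rw [hx1 S h1 h2]; simp [h1, h2]
    · rw [hx2 S h1 h2]; simp [h1, h2]
    · rw [hboth S (by simp [h1, h2])]; simp [h1, h2]
  have hw : ∀ t, 0 ≤ w t := by
    intro t
    by_cases ht : t ≤ W.card
    · simp only [w, ht, if_true]
      obtain ⟨h1, -⟩ := hT t ht
      -- Deleting x' from a ballot with value 0 can only favour x, and what remains is a ballot of
      -- value w t.
      have hd : (insert x' (insert x (T t))) \ {x'} = insert x (T t) := by
        rw [← Finset.erase_eq, Finset.erase_insert]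
        simpa [hne.symm] using fun h => hx' (h1 h)
      have := hlos (insert x' (insert x (T t))) {x'} (by simpa using hne) (by simpa using hx')
        (by rw [hd]; simp)
      rwa [map_sub, hd, hboth (insert x' (insert x (T t))) (by simp), sub_zero] at this
    · simp [w, ht]
  refine ⟨w, hw, ?_, fun z => by rw [hφ, hform, sub_nonneg]⟩
  -- If all weights vanished, φ would be 0 and x would weakly beat x' even where x' is the only
  -- choice.
  by_contra! hcon
  have hw0 : ∀ t, w t = 0 := by
    intro t
    by_cases ht : t ≤ W.card
    · exact le_antisymm (hcon t ht) (hw t)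
    · simp [w, ht]
  obtain ⟨a, ha⟩ := hs x' hx'
  have h1 : φ a = 0 := by simp [hform, gain, hw0]
  obtain ⟨q, h2, h3, h4⟩ := (hφ a).2 h1.ge
  exact hne (hG.eq_of_mem_of_singleton ha h3 h4)

end RegularChoice

end Representation

/-! ### Profiles and their ballot counts -/

namespace Profile

variable {C : Type*} [DecidableEq C]

/-- The number of voters who cast a given ballot. -/
def count (A : Profile C) (S : Finset C) : ℤ :=
  ((A.voters.filter fun i => A.ballot i = S).card : ℤ)

/-- `A` has the ballot counts that are prescribed by `z`. -/
def Realizes (A : Profile C) (z : Finset C → ℤ) : Prop :=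
  ∀ S : Finset C, S.Nonempty → A.count S = z S

theorem realizes_count (A : Profile C) : A.Realizes A.count := fun _ _ => rfl

theorem count_empty (A : Profile C) : A.count ∅ = 0 := by
  rw [count, Nat.cast_eq_zero, Finset.card_eq_zero, Finset.filter_eq_empty_iff]
  intro i hi h
  have := (A.ballot_nonempty_iff i).2 hi
  rw [h] at this
  exact Finset.not_nonempty_empty this

theorem mem_filter_ballot {A : Profile C} {S : Finset C} (hS : S.Nonempty) (i : ℕ+) :
    i ∈ (A.voters.filter fun i => A.ballot i = S) ↔ A.ballot i = S := by
  rw [Finset.mem_filter, and_iff_right_iff_imp]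
  rintro rfl
  exact (A.ballot_nonempty_iff i).1 hS

omit [DecidableEq C] in
theorem ballot_eq_empty_iff (A : Profile C) (i : ℕ+) : A.ballot i = ∅ ↔ i ∉ A.voters := by
  rw [← A.ballot_nonempty_iff, Finset.not_nonempty_iff_eq_empty]

theorem exists_realizes [Fintype C] {z : Finset C → ℤ}
    (hz : ∀ S : Finset C, S.Nonempty → 0 ≤ z S) (hz' : ∃ S : Finset C, S.Nonempty ∧ 0 < z S)
    (F : Finset ℕ+) : ∃ A : Profile C, A.Realizes z ∧ Disjoint A.voters F := by
  classical
  let α := Σ S : {S : Finset C // S.Nonempty}, Fin (z S.1).toNat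
  have : Infinite {i : ℕ+ // i ∉ F} := F.finite_toSet.infinite_compl.to_subtype
  -- One voter per required ballot, drawn from the infinitely many names outside F.
  let e : α ↪ ℕ+ := ((Fintype.equivFin α).toEmbedding.trans Fin.valEmbedding).trans
    ((Infinite.natEmbedding {i : ℕ+ // i ∉ F}).trans (Function.Embedding.subtype _))
  have he : ∀ a, e a ∉ F := fun a =>
    (Infinite.natEmbedding {i : ℕ+ // i ∉ F} (Fintype.equivFin α a)).2
  let b : ℕ+ → Finset C := fun i => if h : ∃ a, e a = i then h.choose.1.1 else ∅
  have hb : ∀ a, b (e a) = a.1.1 := by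
    intro a
    have h : ∃ a', e a' = e a := ⟨a, rfl⟩
    have h' := e.injective h.choose_spec
    simp only [b, h, dif_pos]
    rw [h']
  have hb' : ∀ i, (¬ ∃ a, e a = i) → b i = ∅ := fun i h => dif_neg h
  obtain ⟨S₀, hS₀, hzS₀⟩ := hz'
  let A : Profile C :=
    { voters := Finset.univ.map e
      ballot := b
      voters_nonempty := by
        rw [Finset.map_nonempty]
        exact ⟨⟨⟨S₀, hS₀⟩, ⟨0, by change 0 < (z S₀).toNat; omega⟩⟩, Finset.mem_univ _⟩
      ballot_nonempty_iff := by
        intro i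
        by_cases h : ∃ a, e a = i
        · obtain ⟨a, rfl⟩ := h
          simp [hb, a.1.2]
        · rw [hb' i h]
          simpa using h }
  refine ⟨A, fun S hS => ?_, ?_⟩
  · have h1 : (A.voters.filter fun i => A.ballot i = S)
        = (Finset.univ : Finset (Fin (z S).toNat)).map
          ((Function.Embedding.sigmaMk (β := fun S : {S : Finset C // S.Nonempty} =>
            Fin (z S.1).toNat) ⟨S, hS⟩).trans e) := by
      ext i
      simp only [A, Finset.mem_filter, Finset.mem_map, Finset.mem_univ, true_and]
      constructor
      · rintro ⟨⟨a, rfl⟩, h⟩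
        rw [hb] at h
        subst h
        exact ⟨a.2, rfl⟩
      · rintro ⟨j, rfl⟩
        exact ⟨⟨_, rfl⟩, hb _⟩
    rw [count, h1, Finset.card_map, Finset.card_univ, Fintype.card_fin, Int.toNat_of_nonneg (hz S hS)]
  · rw [Finset.disjoint_left]
    intro i hi
    obtain ⟨a, -, rfl⟩ := Finset.mem_map.1 hi
    exact he a

theorem count_add {A B : Profile C} (h : Disjoint A.voters B.voters) :
    (A.add B).count = A.count + B.count := by
  funext S
  have h1 : ((A.add B).voters.filter fun i => (A.add B).ballot i = S)
      = (A.voters.filter fun i => A.ballot i = S) ∪ (B.voters.filter fun i => B.ballot i = S) := by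
    ext i
    rw [Finset.mem_union, Finset.mem_filter, Finset.mem_filter, Finset.mem_filter]
    by_cases hi : i ∈ A.voters
    · have := Finset.disjoint_left.1 h hi
      simp [add, hi, this]
    · simp [add, hi]
  rw [Pi.add_apply, count, h1, Finset.card_union_of_disjoint]
  · push_cast; rfl
  · exact Disjoint.mono (Finset.filter_subset _ _) (Finset.filter_subset _ _) h

theorem Realizes.add {A B : Profile C} {z z' : Finset C → ℤ} (hA : A.Realizes z)
    (hB : B.Realizes z') (h : Disjoint A.voters B.voters) : (A.add B).Realizes (z + z') := by
  intro S hS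
  rw [count_add h, Pi.add_apply, Pi.add_apply, hA S hS, hB S hS]

theorem isCopies_iff {A B : Profile C} {j : ℕ} : IsCopies j A B ↔ B.Realizes (j • A.count) := by
  have h : ∀ S : Finset C, ((B.voters.filter fun i => B.ballot i = S).card
      = j * (A.voters.filter fun i => A.ballot i = S).card ↔ B.count S = (j • A.count) S) := by
    intro S
    rw [Pi.smul_apply, count, count, nsmul_eq_mul]
    norm_cast
  constructor
  · exact fun hc S _ => (h S).1 (hc S)
  · intro hr S
    rw [h]
    rcases S.eq_empty_or_nonempty with rfl | hS
    · rw [Pi.smul_apply, count_empty, count_empty, smul_zero]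
    · exact hr S hS

theorem count_permuteCandidates (τ : Equiv.Perm C) (A : Profile C) :
    (A.permuteCandidates τ).count = permVec τ A.count := by
  funext S
  rw [permVec_apply, count, count]
  congr 2
  refine Finset.filter_congr fun i _ => ?_
  constructor
  · rintro rfl
    exact (Finset.map_perm_map_symm τ _).symm
  · intro h
    change (A.ballot i).map τ.toEmbedding = S
    rw [h, Finset.map_perm_symm_map]

theorem Realizes.permuteCandidates {A : Profile C} {z : Finset C → ℤ} (hA : A.Realizes z)
    (τ : Equiv.Perm C) : (A.permuteCandidates τ).Realizes (permVec τ z) := by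
  intro S hS
  rw [count_permuteCandidates, permVec_apply, permVec_apply]
  exact hA _ (Finset.map_nonempty.2 hS)

theorem count_permuteVoters (π : Equiv.Perm ℕ+) (A : Profile C) :
    (A.permuteVoters π).count = A.count := by
  funext S
  rw [count, count]
  congr 1
  refine Finset.card_bij (fun i _ => π.symm i) ?_ ?_ ?_
  · intro i hi
    rw [Finset.mem_filter] at hi ⊢
    exact ⟨Finset.mem_map_equiv.1 hi.1, hi.2⟩
  · intro i _ j _ h
    exact π.symm.injective h
  · intro i hi
    rw [Finset.mem_filter] at hi
    refine ⟨π i, ?_, π.symm_apply_apply i⟩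
    rw [Finset.mem_filter]
    refine ⟨Finset.mem_map_equiv.2 (by rw [Equiv.symm_apply_apply]; exact hi.1), ?_⟩
    change A.ballot (π.symm (π i)) = S
    rw [Equiv.symm_apply_apply]
    exact hi.2

/-- Profiles with the same ballot counts differ only by the names of the voters. -/
theorem exists_permuteVoters_eq {A B : Profile C}
    (h : ∀ S : Finset C, S.Nonempty → A.count S = B.count S) :
    ∃ π : Equiv.Perm ℕ+, A.permuteVoters π = B := by
  obtain ⟨π, hπ⟩ := exists_perm_of_fiber_equiv A.ballot B.ballot (by
    intro S
    rcases S.eq_empty_or_nonempty with rfl | hS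
    -- The empty ballot marks the non-voters; both sets of them are countably infinite.
    · have hA : Infinite {i : ℕ+ // A.ballot i = ∅} := by
        simp only [ballot_eq_empty_iff]
        exact A.voters.finite_toSet.infinite_compl.to_subtype
      have hB : Infinite {i : ℕ+ // B.ballot i = ∅} := by
        simp only [ballot_eq_empty_iff]
        exact B.voters.finite_toSet.infinite_compl.to_subtype
      exact nonempty_equiv_of_countable
    · have e := Finset.equivOfCardEq (Nat.cast_injective (R := ℤ) (h S hS))
      exact ⟨((Equiv.subtypeEquivRight fun i => (mem_filter_ballot hS i).symm).trans e).trans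
        (Equiv.subtypeEquivRight fun i => mem_filter_ballot hS i)⟩)
  refine ⟨π, ?_⟩
  have hballot : ∀ i, A.ballot (π.symm i) = B.ballot i := by
    intro i
    rw [← hπ, Equiv.apply_symm_apply]
  ext i : 2
  · change i ∈ A.voters.map π.toEmbedding ↔ i ∈ B.voters
    rw [Finset.mem_map_equiv, ← A.ballot_nonempty_iff, ← B.ballot_nonempty_iff, hballot]
  · exact hballot i

theorem gain_count [Fintype C] (w : ℕ → ℝ) (A : Profile C) (W : Finset C) (x : C) :
    gain w A.count W x =
      ∑ i ∈ A.voters, if x ∈ A.ballot i then w (A.ballot i ∩ W).card else 0 := by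
  rw [← Finset.sum_fiberwise A.voters A.ballot, gain]
  refine Finset.sum_congr rfl fun S _ => ?_
  rw [Finset.sum_congr rfl (g := fun _ => if x ∈ S then w (S ∩ W).card else 0)
    fun i hi => by rw [(Finset.mem_filter.1 hi).2], Finset.sum_const, nsmul_eq_mul, count]
  split_ifs <;> simp

end Profile

/-! ### Rules governed by weights -/

section Rules

variable {C : Type*} [Fintype C]

theorem ABCRule.chosen_zero (f : ABCRule C) (A : Profile C) : f.chosen A 0 = {∅} := by
  obtain ⟨W, hW⟩ := f.chosen_nonempty A 0 (Nat.zero_le _)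
  have h : ∀ V ∈ f.chosen A 0, V = ∅ := fun V hV => Finset.card_eq_zero.1 (f.card_eq A 0 V hV)
  ext V
  exact ⟨h V, fun hV => by rw [hV, ← h W hW]; exact hW⟩

variable [DecidableEq C]

theorem ABCRule.Anonymous.chosen_eq {f : ABCRule C} (hf : f.Anonymous) {A B : Profile C}
    {z : Finset C → ℤ} (hA : A.Realizes z) (hB : B.Realizes z) {k : ℕ}
    (hk : k ≤ Fintype.card C) : f.chosen A k = f.chosen B k := by
  obtain ⟨π, rfl⟩ := Profile.exists_permuteVoters_eq (A := A) (B := B)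
    fun S hS => (hA S hS).trans (hB S hS).symm
  exact hf A k π hk

/-- In the `k`-th step, `f` adds the candidates that maximise the `gain` for the weights `w`. -/
structure LevelWeights (f : ABCRule C) (k : ℕ) (w : ℕ → ℝ) : Prop where
  nonneg : ∀ t, 0 ≤ w t
  -- In the last step a single candidate remains, and the weights are immaterial.
  exists_pos : k + 1 < Fintype.card C → ∃ t ≤ k, 0 < w t
  chosen_succ : ∀ A, f.chosen A (k + 1) = {W' | ∃ W ∈ f.chosen A k, ∃ x ∉ W,
    (∀ y ∉ W, gain w A.count W y ≤ gain w A.count W x) ∧ W' = insert x W}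

/-- Whenever the current committee is a proper subset of `W`, all remaining members of `W` are
strictly better than all candidates outside of `W`. -/
def Separates (w : ℕ → ℕ → ℝ) (W : Finset C) (z : Finset C → ℤ) : Prop :=
  ∀ V ⊆ W, ∀ x ∈ W, x ∉ V → ∀ y ∉ W, gain (w V.card) z V y < gain (w V.card) z V x

theorem Separates.add {w : ℕ → ℕ → ℝ} {W : Finset C} {z z' : Finset C → ℤ}
    (h : Separates w W z) (h' : Separates w W z') : Separates w W (z + z') := by
  intro V hV x hx hxV y hy
  rw [gain_add, gain_add]
  exact add_lt_add (h V hV x hx hxV y hy) (h' V hV x hx hxV y hy)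

theorem eventually_add_nsmul_lt {a b : ℝ} (h : a < b) (c d : ℝ) :
    ∀ᶠ j : ℕ in atTop, c + j * a < d + j * b := by
  obtain ⟨n, hn⟩ := exists_nat_gt ((c - d) / (b - a))
  filter_upwards [eventually_ge_atTop n] with j hj
  have h1 : (c - d) / (b - a) < j := hn.trans_le (Nat.cast_le.2 hj)
  rw [div_lt_iff₀ (sub_pos.2 h)] at h1
  linarith

theorem Separates.eventually {w : ℕ → ℕ → ℝ} {W : Finset C} {a : Finset C → ℤ}
    (h : Separates w W a) (z : Finset C → ℤ) :
    ∀ᶠ j : ℕ in atTop, Separates w W (z + j • a) := by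
  have : ∀ V : Finset C, ∀ x y : C, ∀ᶠ j : ℕ in atTop, V ⊆ W → x ∈ W → x ∉ V → y ∉ W →
      gain (w V.card) (z + j • a) V y < gain (w V.card) (z + j • a) V x := by
    intro V x y
    by_cases hV : V ⊆ W ∧ x ∈ W ∧ x ∉ V ∧ y ∉ W
    · obtain ⟨h1, h2, h3, h4⟩ := hV
      filter_upwards [eventually_add_nsmul_lt (h V h1 x h2 h3 y h4) (gain (w V.card) z V y)
        (gain (w V.card) z V x)] with j hj _ _ _ _
      rwa [gain_add, gain_add, gain_nsmul, gain_nsmul]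
    · exact Eventually.of_forall fun j h1 h2 h3 h4 => absurd ⟨h1, h2, h3, h4⟩ hV
  simp only [← eventually_all] at this
  filter_upwards [this] with j hj V hV x hx hxV y hy
  exact hj V x y hV hx hxV hy

theorem Separates.congr {w : ℕ → ℕ → ℝ} {W : Finset C} {z z' : Finset C → ℤ}
    (h : Separates w W z) (hz : ∀ S : Finset C, S.Nonempty → z S = z' S) :
    Separates w W z' := by
  intro V hV x hx hxV y hy
  rw [← gain_congr _ V y hz, ← gain_congr _ V x hz]
  exact h V hV x hx hxV y hy

/-- As long as the committee is a proper subset of W, some member of W is left and beats every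
candidate outside W, so no step leaves W. -/
theorem Separates.chosen_eq {f : ABCRule C} {w : ℕ → ℕ → ℝ} {W : Finset C}
    (hf : ∀ k < W.card, LevelWeights f k (w k)) {z : Finset C → ℤ} (h : Separates w W z)
    {A : Profile C} (hA : A.Realizes z) : f.chosen A W.card = {W} := by
  have hA' : Separates w W A.count := h.congr fun S hS => (hA S hS).symm
  have hsub : ∀ k ≤ W.card, ∀ V ∈ f.chosen A k, V ⊆ W := by
    intro k
    induction k with
    | zero => intro _ V hV; rw [f.chosen_zero] at hV; rw [hV]; exact Finset.empty_subset W
    | succ k ih =>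
      intro hk V' hV'
      rw [(hf k hk).chosen_succ] at hV'
      obtain ⟨V, hV, x, hx, hmax, rfl⟩ := hV'
      have hVW := ih (Nat.le_of_succ_le hk) V hV
      have hcard := f.card_eq A k V hV
      obtain ⟨c, hcW, hcV⟩ : ∃ c ∈ W, c ∉ V :=
        Finset.exists_mem_notMem_of_card_lt_card (by omega)
      refine Finset.insert_subset ?_ hVW
      by_contra hxW
      have := hA' V hVW c hcW hcV x hxW
      rw [hcard] at this
      exact absurd (hmax c hcV) (not_le.2 this)
  have h1 : ∀ V ∈ f.chosen A W.card, V = W := fun V hV =>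
    Finset.eq_of_subset_of_card_le (hsub W.card le_rfl V hV) (f.card_eq A W.card V hV).ge
  obtain ⟨V, hV⟩ := f.chosen_nonempty A W.card (Finset.card_le_univ W)
  rw [h1 V hV] at hV
  ext U
  exact ⟨h1 U, fun hU => by rw [hU]; exact hV⟩

theorem gain_weights_congr {w w' : ℕ → ℝ} {W : Finset C} (h : ∀ t ≤ W.card, w t = w' t)
    (z : Finset C → ℤ) (x : C) : gain w z W x = gain w' z W x := by
  refine Finset.sum_congr rfl fun S _ => ?_
  rw [h _ (Finset.card_le_card Finset.inter_subset_right)]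

theorem score_insert (h : ℕ → ℝ) (A : Profile C) {W : Finset C} {x : C} (hx : x ∉ W) :
    score (fun S W => h (S ∩ W).card) A (insert x W) =
      score (fun S W => h (S ∩ W).card) A W + gain (fun t => h (t + 1) - h t) A.count W x := by
  rw [Profile.gain_count, score, score, ← Finset.sum_add_distrib]
  refine Finset.sum_congr rfl fun i _ => ?_
  by_cases hi : x ∈ A.ballot i
  · rw [Finset.inter_insert_of_mem hi, Finset.card_insert_of_notMem (by simp [hx]), if_pos hi]
    ring
  · rw [Finset.inter_insert_of_notMem hi, if_neg hi, add_zero]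

/-- Weights are increments of h in the first argument, and h is recovered by partial sums. Step k
builds committees of size k + 1, hence the shift in the second argument. -/
theorem isStepDependentSequentialThieleRule_iff (f : ABCRule C) :
    f.IsStepDependentSequentialThieleRule ↔
      ∃ w : ℕ → ℕ → ℝ, ∀ k < Fintype.card C, LevelWeights f k (w k) := by
  have key : ∀ (h : ℕ → ℕ → ℝ) (A : Profile C) (k : ℕ) (W : Finset C), W.card = k →
      ∀ x ∉ W, ∀ y ∉ W,
      (score (fun S W => h (S ∩ W).card W.card) A (insert y W)
        ≤ score (fun S W => h (S ∩ W).card W.card) A (insert x W) ↔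
      gain (fun t => h (t + 1) (k + 1) - h t (k + 1)) A.count W y
        ≤ gain (fun t => h (t + 1) (k + 1) - h t (k + 1)) A.count W x) := by
    intro h A k W hW x hx y hy
    have : ∀ u ∉ W, score (fun S W => h (S ∩ W).card W.card) A (insert u W)
        = score (fun S W => h (S ∩ W).card (k + 1)) A (insert u W) := by
      intro u hu
      simp only [score, Finset.card_insert_of_notMem hu, hW]
    rw [this x hx, this y hy, score_insert (fun t => h t (k + 1)) A hx,
      score_insert (fun t => h t (k + 1)) A hy, add_le_add_iff_left]
  constructor
  · rintro ⟨h, hh, hf⟩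
    -- Ballots meet a committee of size k in at most k candidates. Cutting off beyond k makes the
    -- weights nonnegative for every t, where h itself may be arbitrary.
    refine ⟨fun k t => if t ≤ k then h (t + 1) (k + 1) - h t (k + 1) else 0, fun k hk =>
      ⟨fun t => ?_, fun hk' => ?_, fun A => ?_⟩⟩
    · dsimp only
      split_ifs with ht
      · exact sub_nonneg.2 (hh.mono _ _ _ (Nat.le_succ t) (by omega) (by omega) (by omega))
      · exact le_rfl
    · obtain ⟨x, h1, h2, h3⟩ := hh.exists_lt (k + 1) (by omega) hk'
      refine ⟨x - 1, by omega, ?_⟩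
      dsimp only
      rw [if_pos (by omega), Nat.sub_add_cancel h1]
      exact sub_pos.2 h3
    · rw [(hf A).2 k hk]
      ext W'
      simp only [Set.mem_ofPred_eq]
      refine exists_congr fun W => and_congr_right fun hW => exists_congr fun x =>
        and_congr_right fun hx => and_congr_left fun _ => forall₂_congr fun y hy => ?_
      have hc := f.card_eq A k W hW
      have hw : ∀ t ≤ W.card, h (t + 1) (k + 1) - h t (k + 1)
          = if t ≤ k then h (t + 1) (k + 1) - h t (k + 1) else 0 :=
        fun t ht => (if_pos (ht.trans hc.le)).symm
      rw [key h A k W hc x hx y hy, gain_weights_congr hw, gain_weights_congr hw]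
  · rintro ⟨w, hw⟩
    let h : ℕ → ℕ → ℝ := fun i y => ∑ t ∈ Finset.range i, w (y - 1) t
    refine ⟨h, ⟨fun x y _ h1 h2 => ?_, fun x x' y hx _ h1 h2 => ?_, fun y h1 h2 => ?_⟩,
      fun A => ⟨f.chosen_zero A, fun k hk => ?_⟩⟩
    · exact Finset.sum_nonneg fun t _ => (hw (y - 1) (by omega)).nonneg t
    · exact Finset.sum_le_sum_of_subset_of_nonneg (Finset.range_mono hx)
        fun t _ _ => (hw (y - 1) (by omega)).nonneg t
    · obtain ⟨t, h3, h4⟩ := (hw (y - 1) (by omega)).exists_pos (by omega)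
      refine ⟨t + 1, by omega, by omega, ?_⟩
      simp only [h, Nat.add_sub_cancel, Finset.sum_range_succ]
      linarith
    · rw [(hw k hk).chosen_succ]
      ext W'
      simp only [Set.mem_ofPred_eq]
      refine exists_congr fun W => and_congr_right fun hW => exists_congr fun x =>
        and_congr_right fun hx => and_congr_left fun _ => forall₂_congr fun y hy => ?_
      rw [key h A k W (f.card_eq A k W hW) x hx y hy]
      have : (fun t => h (t + 1) (k + 1) - h t (k + 1)) = w k := by
        funext t
        simp only [h, Nat.add_sub_cancel, Finset.sum_range_succ]
        ring
      rw [this]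

end Rules

/-! ### Thiele rules satisfy the axioms -/

section Forward

variable {C : Type*} [Fintype C] [DecidableEq C] {f : ABCRule C}

/-- One vote for every ballot, and a second one for the ballots that are contained in `W`. -/
def baseVec (W : Finset C) : Finset C → ℤ :=
  (fun _ => 1) + fun S => if S ⊆ W then 1 else 0

omit [Fintype C] in
theorem baseVec_pos (W S : Finset C) : 0 < baseVec W S := by
  simp only [baseVec, Pi.add_apply]
  split_ifs <;> norm_num

omit [Fintype C] in
theorem permVec_baseVec (τ : Equiv.Perm C) (W : Finset C) :
    permVec τ (baseVec W) = baseVec (W.map τ.toEmbedding) := by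
  funext S
  have : S.map τ.symm.toEmbedding ⊆ W ↔ S ⊆ W.map τ.toEmbedding := by
    conv_rhs => rw [← Finset.map_perm_symm_map τ S]
    exact Finset.map_subset_map.symm
  simp only [permVec_apply, baseVec, Pi.add_apply, this]

/-- The constant part of `baseVec W` gives x and y equal gains by symmetry. The ballots inside W
give y nothing, while some ballot consisting of x and t members of V has positive weight for x. -/
theorem separates_baseVec {w : ℕ → ℕ → ℝ} {W : Finset C} (h0 : ∀ k < W.card, ∀ t, 0 ≤ w k t)
    (h1 : ∀ k < W.card, k + 1 < Fintype.card C → ∃ t ≤ k, 0 < w k t) :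
    Separates w W (baseVec W) := by
  intro V hV x hx hxV y hy
  have hyV : y ∉ V := fun h => hy (hV h)
  have hcard : V.card < W.card := Finset.card_lt_card ⟨hV, fun h => hxV (h hx)⟩
  have hcard' : V.card + 1 < Fintype.card C :=
    lt_of_le_of_lt hcard (Finset.card_lt_univ_of_notMem hy)
  have hsym : gain (w V.card) (fun _ => 1) V y = gain (w V.card) (fun _ => 1) V x := by
    have := gain_permVec (w V.card) (Equiv.swap x y) (fun _ => 1) V x
    rwa [Finset.map_swap_of_notMem hxV hyV, Equiv.swap_apply_left] at this
  rw [baseVec, gain_add, gain_add, hsym]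
  refine add_lt_add_of_le_of_lt le_rfl ?_
  have hz : gain (w V.card) (fun S => if S ⊆ W then 1 else 0) V y = 0 := by
    refine Finset.sum_eq_zero fun S _ => ?_
    split_ifs with h2
    · have h3 : ¬ S ⊆ W := fun h3 => hy (h3 h2)
      simp [h3]
    · rfl
  rw [hz]
  obtain ⟨t, ht, htw⟩ := h1 V.card hcard hcard'
  obtain ⟨T, hT, hTt⟩ := Finset.exists_subset_card_eq ht
  refine Finset.sum_pos' (fun S _ => ?_) ⟨insert x T, Finset.mem_univ _, ?_⟩
  · have := h0 V.card hcard (S ∩ V).card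
    by_cases h2 : x ∈ S <;> by_cases h3 : S ⊆ W <;> simp [h2, h3, this]
  · dsimp only
    rw [if_pos (Finset.mem_insert_self x T),
      if_pos (Finset.insert_subset hx (hT.trans hV)), Finset.insert_inter_of_notMem hxV,
      Finset.inter_eq_left.2 hT, hTt]
    simpa using htw

namespace LevelWeights

variable {w : ℕ → ℕ → ℝ}

/-- If every strict comparison of gains for A also holds for B, then a maximiser for B is not
strictly beaten for A. -/
theorem chosen_subset (hw : ∀ k < Fintype.card C, LevelWeights f k (w k)) {A B : Profile C}
    (h : ∀ (V : Finset C) (x y : C), gain (w V.card) A.count V y < gain (w V.card) A.count V x →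
      gain (w V.card) B.count V y < gain (w V.card) B.count V x) :
    ∀ k ≤ Fintype.card C, f.chosen B k ⊆ f.chosen A k := by
  intro k
  induction k with
  | zero => rw [f.chosen_zero, f.chosen_zero]; exact fun _ => le_rfl
  | succ k ih =>
    intro hk W' hW'
    rw [(hw k hk).chosen_succ] at hW' ⊢
    obtain ⟨W, hW, x, hx, hmax, rfl⟩ := hW'
    refine ⟨W, ih (Nat.le_of_succ_le hk) hW, x, hx, fun y hy => ?_, rfl⟩
    by_contra! hlt
    rw [← f.card_eq B k W hW] at hlt hmax
    exact absurd (hmax y hy) (not_le.2 (h W y x hlt))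

theorem chosen_eq_of_count_eq (hw : ∀ k < Fintype.card C, LevelWeights f k (w k))
    {A B : Profile C} (h : A.count = B.count) {k : ℕ} (hk : k ≤ Fintype.card C) :
    f.chosen A k = f.chosen B k :=
  Set.Subset.antisymm (chosen_subset hw (fun V x y => by rw [h]; exact id) k hk)
    (chosen_subset hw (fun V x y => by rw [h]; exact id) k hk)

theorem anonymous (hw : ∀ k < Fintype.card C, LevelWeights f k (w k)) : f.Anonymous :=
  fun A _ π hk => chosen_eq_of_count_eq hw (A.count_permuteVoters π).symm hk

theorem map_mem_chosen (hw : ∀ k < Fintype.card C, LevelWeights f k (w k)) (A : Profile C)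
    (τ : Equiv.Perm C) : ∀ k ≤ Fintype.card C, ∀ W ∈ f.chosen A k,
      W.map τ.toEmbedding ∈ f.chosen (A.permuteCandidates τ) k := by
  intro k
  induction k with
  | zero =>
    intro _ W hW
    rw [f.chosen_zero] at hW ⊢
    rw [hW]; rfl
  | succ k ih =>
    intro hk W' hW'
    rw [(hw k hk).chosen_succ] at hW' ⊢
    obtain ⟨W, hW, x, hx, hmax, rfl⟩ := hW'
    refine ⟨_, ih (Nat.le_of_succ_le hk) W hW, τ x, by simpa using hx, fun y hy => ?_, ?_⟩
    · rw [← τ.apply_symm_apply y, Profile.count_permuteCandidates, gain_permVec, gain_permVec]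
      refine hmax _ fun h => hy ?_
      rwa [Finset.mem_map_equiv]
    · rw [Finset.map_insert]; rfl

theorem neutral (hw : ∀ k < Fintype.card C, LevelWeights f k (w k)) : f.Neutral := by
  intro A k τ hk
  ext W
  constructor
  · intro hW
    refine ⟨W.map τ.symm.toEmbedding, ?_, Finset.map_perm_symm_map τ W⟩
    have h1 := map_mem_chosen hw _ τ⁻¹ k hk W hW
    rwa [chosen_eq_of_count_eq hw (B := A) ?_ hk] at h1
    rw [Profile.count_permuteCandidates, Profile.count_permuteCandidates, ← permVec_mul,
      inv_mul_cancel, permVec_one]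
  · rintro ⟨V, hV, rfl⟩
    exact map_mem_chosen hw A τ k hk V hV

theorem continuous (hw : ∀ k < Fintype.card C, LevelWeights f k (w k)) : f.Continuous := by
  intro A A' k W _ hk hW
  -- There are finitely many strict comparisons for A, and each survives the addition of A' once A
  -- is repeated often enough.
  have h1 : ∀ (V : Finset C) (x y : C), ∀ᶠ j : ℕ in atTop,
      gain (w V.card) A.count V y < gain (w V.card) A.count V x →
      gain (w V.card) (A'.count + j • A.count) V y
        < gain (w V.card) (A'.count + j • A.count) V x := by
    intro V x y
    by_cases h : gain (w V.card) A.count V y < gain (w V.card) A.count V x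
    · filter_upwards [eventually_add_nsmul_lt h (gain (w V.card) A'.count V y)
        (gain (w V.card) A'.count V x)] with j hj _
      rwa [gain_add, gain_add, gain_nsmul, gain_nsmul]
    · exact Eventually.of_forall fun j h' => absurd h' h
  simp only [← eventually_all] at h1
  obtain ⟨j, hj, hj1⟩ := (h1.and (eventually_ge_atTop 1)).exists
  refine ⟨j, hj1, fun B hB hdisj => ?_⟩
  have hcount : ∀ S : Finset C, S.Nonempty → (A'.count + j • A.count) S = (B.add A').count S := by
    intro S hS
    rw [Profile.count_add hdisj, Pi.add_apply, Pi.add_apply, Profile.isCopies_iff.1 hB S hS,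
      add_comm]
  have hsub : f.chosen (B.add A') k ⊆ f.chosen A k := by
    refine chosen_subset hw (fun V x y hlt => ?_) k hk
    rw [← gain_congr _ V y hcount, ← gain_congr _ V x hcount]
    exact hj V x y hlt
  rw [hW] at hsub
  exact (Set.Nonempty.subset_singleton_iff (f.chosen_nonempty _ k hk)).1 hsub

theorem nonImposing [Nonempty C] (hw : ∀ k < Fintype.card C, LevelWeights f k (w k)) :
    f.NonImposing := by
  intro W
  obtain ⟨c⟩ := ‹Nonempty C›
  obtain ⟨A, hA, -⟩ := Profile.exists_realizes (z := baseVec W) (fun S _ => (baseVec_pos W S).le)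
    ⟨{c}, by simp, baseVec_pos W _⟩ ∅
  have hW := Finset.card_le_univ W
  exact ⟨A, (separates_baseVec (fun k hk => (hw k (hk.trans_le hW)).nonneg)
    (fun k hk => (hw k (hk.trans_le hW)).exists_pos)).chosen_eq
    (fun k hk => hw k (hk.trans_le hW)) hA⟩

theorem proper [Nonempty C] (hw : ∀ k < Fintype.card C, LevelWeights f k (w k)) : f.Proper :=
  ⟨anonymous hw, neutral hw, continuous hw, nonImposing hw⟩

theorem independentOfLosers (hw : ∀ k < Fintype.card C, LevelWeights f k (w k)) :
    f.IndependentOfLosers := by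
  intro A A' W hv hAA' hWA
  -- All committees on a path to W lie in W, where the ballots agree. The gain of the next member is
  -- thus unchanged, while no competitor gains more than before.
  have key : ∀ k ≤ Fintype.card C, ∀ V ⊆ W, V ∈ f.chosen A k → V ∈ f.chosen A' k := by
    intro k
    induction k with
    | zero => intro _ V _ hV; rwa [f.chosen_zero] at hV ⊢
    | succ k ih =>
      intro hk V' hV'W hV'
      rw [(hw k hk).chosen_succ] at hV' ⊢
      obtain ⟨V, hV, x, hx, hmax, rfl⟩ := hV'
      have hxW : x ∈ W := hV'W (Finset.mem_insert_self x V)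
      have hVW : V ⊆ W := (Finset.subset_insert x V).trans hV'W
      have hmem : ∀ i ∈ A.voters, ∀ a ∈ W, (a ∈ A.ballot i ↔ a ∈ A'.ballot i) := by
        intro i hi a ha
        have := Finset.ext_iff.1 (hAA' i hi).1 a
        simpa [ha] using this
      have hinter : ∀ i ∈ A.voters, A.ballot i ∩ V = A'.ballot i ∩ V := by
        intro i hi
        ext a
        simp only [Finset.mem_inter, and_congr_left_iff]
        exact fun ha => hmem i hi a (hVW ha)
      refine ⟨V, ih (Nat.le_of_succ_le hk) V hVW hV, x, hx, fun y hy => ?_, rfl⟩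
      calc gain (w k) A'.count V y ≤ gain (w k) A.count V y := by
            rw [Profile.gain_count, Profile.gain_count, ← hv]
            refine Finset.sum_le_sum fun i hi => ?_
            by_cases h1 : y ∈ A'.ballot i
            · rw [if_pos h1, if_pos ((hAA' i hi).2 h1), hinter i hi]
            · rw [if_neg h1]
              split_ifs
              · exact (hw k hk).nonneg _
              · exact le_rfl
        _ ≤ gain (w k) A.count V x := hmax y hy
        _ = gain (w k) A'.count V x := by
            rw [Profile.gain_count, Profile.gain_count, ← hv]
            refine Finset.sum_congr rfl fun i hi => ?_
            rw [hinter i hi, if_congr (hmem i hi x hxW) rfl rfl]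
  exact key _ (Finset.card_le_univ W) W le_rfl hWA

theorem consistentlyCommitteeMonotone (hw : ∀ k < Fintype.card C, LevelWeights f k (w k)) :
    f.ConsistentlyCommitteeMonotone := by
  classical
  let g : GeneratorFunction C :=
    { next := fun A W => Finset.univ.filter fun x => x ∉ W ∧
        ∀ y ∉ W, gain (w W.card) A.count W y ≤ gain (w W.card) A.count W x
      disjoint := fun A W => Finset.disjoint_left.2 fun x hx => (Finset.mem_filter.1 hx).2.1 }
  have hg : ∀ A W x, x ∈ g.next A W ↔ x ∉ W ∧
      ∀ y ∉ W, gain (w W.card) A.count W y ≤ gain (w W.card) A.count W x := fun A W x => by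
    simp [g]
  refine ⟨g, ?_, ?_⟩
  · rintro A A' W hdisj - ⟨z, hz⟩ -
    obtain ⟨hz1, hz2⟩ := Finset.mem_inter.1 hz
    ext x
    rw [Finset.mem_inter, hg, hg, hg]
    have hzW := ((hg A W z).1 hz1).1
    have hA := ((hg A W z).1 hz1).2
    have hA' := ((hg A' W z).1 hz2).2
    simp only [Profile.count_add hdisj, gain_add]
    constructor
    -- Since z is optimal in both parts, x can match it in the sum only by matching it in each part.
    · rintro ⟨hx, h⟩
      have h1 := h z hzW
      have h2 := hA x hx
      have h3 := hA' x hx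
      refine ⟨⟨hx, fun y hy => ?_⟩, hx, fun y hy => ?_⟩
      · have := hA y hy
        linarith
      · have := hA' y hy
        linarith
    · rintro ⟨⟨hx, h1⟩, -, h2⟩
      exact ⟨hx, fun y hy => add_le_add (h1 y hy) (h2 y hy)⟩
  · intro A k hk
    refine ⟨fun W hW => ?_, ?_⟩
    · have hc := f.card_eq A k W hW
      obtain ⟨c, hc'⟩ : (Wᶜ).Nonempty := by
        rw [← Finset.card_pos, Finset.card_compl]; omega
      obtain ⟨x, hx, hmax⟩ := Finset.exists_max_image Wᶜ (gain (w W.card) A.count W) ⟨c, hc'⟩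
      exact ⟨x, (hg A W x).2 ⟨Finset.mem_compl.1 hx, fun y hy => hmax y (Finset.mem_compl.2 hy)⟩⟩
    · rw [(hw k hk).chosen_succ]
      ext W'
      simp only [Set.mem_ofPred_eq]
      refine exists_congr fun W => and_congr_right fun hW => exists_congr fun x => ?_
      rw [hg, f.card_eq A k W hW, and_assoc]

/-- If the weights do not depend on the step, then the restriction of a winning committee to the
approved candidates of a part of the electorate wins in that part. -/
theorem inter_approved_mem_chosen {v : ℕ → ℝ} (hv : ∀ k < Fintype.card C, LevelWeights f k v)
    {A B : Profile C} (hdisj : Disjoint A.voters B.voters)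
    (happ : Disjoint A.approved B.approved) : ∀ k ≤ Fintype.card C, ∀ W ∈ f.chosen (A.add B) k,
      W ∩ A.approved ∈ f.chosen A (W ∩ A.approved).card := by
  have hmem : ∀ (D : Profile C) (i : ℕ+), i ∈ D.voters → D.ballot i ⊆ D.approved :=
    fun D i hi => Finset.subset_biUnion_of_mem D.ballot hi
  have hzero : ∀ (D : Profile C) (V : Finset C) (y : C), y ∉ D.approved →
      gain v D.count V y = 0 := by
    intro D V y hy
    rw [Profile.gain_count]
    exact Finset.sum_eq_zero fun i hi => if_neg fun h => hy (hmem D i hi h)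
  intro k
  induction k with
  | zero =>
    intro _ W hW
    rw [f.chosen_zero] at hW
    rw [hW, Finset.empty_inter, Finset.card_empty, f.chosen_zero]
    rfl
  | succ k ih =>
    intro hk W' hW'
    rw [(hv k hk).chosen_succ] at hW'
    obtain ⟨W, hW, x, hx, hmax, rfl⟩ := hW'
    have hWA := ih (Nat.le_of_succ_le hk) W hW
    by_cases hxA : x ∈ A.approved
    · have hx' : x ∉ W ∩ A.approved := fun h => hx (Finset.mem_inter.1 h).1
      have hcard := Finset.card_lt_univ_of_notMem hx'
      rw [Finset.insert_inter_of_mem hxA, Finset.card_insert_of_notMem hx',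
        (hv _ hcard).chosen_succ]
      refine ⟨_, hWA, x, hx', fun y hy => ?_, rfl⟩
      by_cases hyA : y ∈ A.approved
      · have hyW : y ∉ W := fun h => hy (Finset.mem_inter.2 ⟨h, hyA⟩)
        -- Voters of B do not approve u, and ballots of A meet W only in approved candidates of A.
        have hgain : ∀ u ∈ A.approved,
            gain v A.count (W ∩ A.approved) u = gain v (A.add B).count W u := by
          intro u hu
          rw [Profile.count_add hdisj, gain_add, hzero B W u (Finset.disjoint_left.1 happ hu),
            add_zero, Profile.gain_count, Profile.gain_count]
          refine Finset.sum_congr rfl fun i hi => ?_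
          rw [Finset.inter_left_comm, Finset.inter_eq_left.2 (hmem A i hi), Finset.inter_comm]
        rw [hgain y hyA, hgain x hxA]
        exact hmax y hyW
      · rw [hzero A _ y hyA, Profile.gain_count]
        refine Finset.sum_nonneg fun i _ => ?_
        split_ifs
        · exact (hv k hk).nonneg _
        · exact le_rfl
    · rwa [Finset.insert_inter_of_notMem hxA]

theorem committeeSeparable {v : ℕ → ℝ} (hv : ∀ k < Fintype.card C, LevelWeights f k v) :
    f.CommitteeSeparable := by
  intro A B W hdisj happ hW
  have happ' : Disjoint A.approved B.approved := by rw [happ]; exact disjoint_compl_right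
  have hcard := Finset.card_le_univ W
  refine ⟨inter_approved_mem_chosen hv hdisj happ' _ hcard W hW,
    inter_approved_mem_chosen hv hdisj.symm happ'.symm _ hcard W ?_⟩
  rwa [chosen_eq_of_count_eq (w := fun _ => v) hv (B := A.add B) _ hcard]
  rw [Profile.count_add hdisj, Profile.count_add hdisj.symm, add_comm]

end LevelWeights

/-- The increments of a single h serve every step, and `0 < v 0` expresses h 1 > h 0. As C is
nonempty, cutting off the weights at m does not affect `v 0`. -/
theorem isSequentialThieleRule_iff [Nonempty C] (f : ABCRule C) :
    f.IsSequentialThieleRule ↔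
      ∃ v : ℕ → ℝ, 0 < v 0 ∧ ∀ k < Fintype.card C, LevelWeights f k v := by
  have key : ∀ (h : ℕ → ℝ) (A : Profile C) (W : Finset C), ∀ x ∉ W, ∀ y ∉ W,
      (score (fun S W => h (S ∩ W).card) A (insert y W)
        ≤ score (fun S W => h (S ∩ W).card) A (insert x W) ↔
      gain (fun t => h (t + 1) - h t) A.count W y
        ≤ gain (fun t => h (t + 1) - h t) A.count W x) := by
    intro h A W x hx y hy
    rw [score_insert h A hx, score_insert h A hy, add_le_add_iff_left]
  have hm : 0 < Fintype.card C := Fintype.card_pos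
  constructor
  · rintro ⟨h, hh, hf⟩
    have hpos : 0 < if 0 < Fintype.card C then h (0 + 1) - h 0 else 0 := by
      rw [if_pos hm]
      exact sub_pos.2 hh.zero_lt_one
    refine ⟨fun t => if t < Fintype.card C then h (t + 1) - h t else 0, hpos, fun k hk =>
      ⟨fun t => ?_, fun _ => ⟨0, Nat.zero_le k, hpos⟩, fun A => ?_⟩⟩
    · split_ifs with ht
      · exact sub_nonneg.2 (hh.mono _ _ (Nat.le_succ t) ht)
      · exact le_rfl
    · rw [(hf A).2 k hk]
      ext W'
      simp only [Set.mem_ofPred_eq]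
      refine exists_congr fun W => and_congr_right fun hW => exists_congr fun x =>
        and_congr_right fun hx => and_congr_left fun _ => forall₂_congr fun y hy => ?_
      have hc := f.card_eq A k W hW
      have hw : ∀ t ≤ W.card, h (t + 1) - h t
          = if t < Fintype.card C then h (t + 1) - h t else 0 :=
        fun t ht => (if_pos (by omega)).symm
      rw [key h A W x hx y hy, gain_weights_congr hw, gain_weights_congr hw]
  · rintro ⟨v, hv0, hv⟩
    have hnn := (hv 0 hm).nonneg
    refine ⟨fun i => ∑ t ∈ Finset.range i, v t, ⟨fun x _ => ?_, fun x x' hx _ => ?_, ?_⟩,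
      fun A => ⟨f.chosen_zero A, fun k hk => ?_⟩⟩
    · exact Finset.sum_nonneg fun t _ => hnn t
    · exact Finset.sum_le_sum_of_subset_of_nonneg (Finset.range_mono hx) fun t _ _ => hnn t
    · simpa using hv0
    · rw [(hv k hk).chosen_succ]
      ext W'
      simp only [Set.mem_ofPred_eq]
      refine exists_congr fun W => and_congr_right fun hW => exists_congr fun x =>
        and_congr_right fun hx => and_congr_left fun _ => forall₂_congr fun y hy => ?_
      rw [key (fun i => ∑ t ∈ Finset.range i, v t) A W x hx y hy]
      have : (fun t => ∑ t ∈ Finset.range (t + 1), v t - ∑ t ∈ Finset.range t, v t) = v := by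
        funext t
        rw [Finset.sum_range_succ]
        ring
      rw [this]

end Forward

/-! ### The axioms yield weights in every step -/

section Backward

variable {C : Type*} [Fintype C] [DecidableEq C] {f : ABCRule C}

/-- The candidates by which `f` extends the committee `W` if sufficiently many voters who make `W`
the unique winning committee, without distinguishing the other candidates, are added to `z`. -/
def nextVec (f : ABCRule C) (W : Finset C) (z : Finset C → ℤ) : Set C :=
  {x | x ∉ W ∧ ∀ᶠ j : ℕ in atTop, ∀ A : Profile C, A.Realizes (z + j • baseVec W) →
    insert x W ∈ f.chosen A (W.card + 1)}

omit [Fintype C] in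
theorem Finset.insert_left_injective_of_notMem {W : Finset C} {x y : C} (hx : x ∉ W)
    (h : insert x W = insert y W) : x = y := by
  have := Finset.mem_insert_self x W
  rw [h, Finset.mem_insert] at this
  exact this.resolve_right hx

theorem eventually_pos_baseVec (W : Finset C) (z : Finset C → ℤ) :
    ∀ᶠ j : ℕ in atTop, ∀ S, 0 < (z + j • baseVec W) S := by
  rw [eventually_all]
  intro S
  filter_upwards [eventually_gt_atTop (z S).natAbs] with j hj
  have h1 : (j : ℤ) ≤ j * baseVec W S :=
    le_mul_of_one_le_right (Int.natCast_nonneg j) (baseVec_pos W S)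
  rw [Pi.add_apply, Pi.smul_apply, nsmul_eq_mul]
  omega

theorem Separates.nsmul {w : ℕ → ℕ → ℝ} {W : Finset C} {z : Finset C → ℤ}
    (h : Separates w W z) {n : ℕ} (hn : 1 ≤ n) : Separates w W (n • z) := by
  induction n, hn using Nat.le_induction with
  | base => rwa [one_smul]
  | succ n hn ih => rw [succ_nsmul]; exact ih.add h

namespace GeneratorFunction

variable {g : GeneratorFunction C}

theorem Generates.mem_next_iff (hg : g.Generates f) {A : Profile C} {W : Finset C}
    (hW : W.card < Fintype.card C) (hA : f.chosen A W.card = {W}) {x : C} :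
    x ∈ g.next A W ↔ x ∉ W ∧ insert x W ∈ f.chosen A (W.card + 1) := by
  rw [(hg A W.card hW).2, hA]
  constructor
  · intro hx
    exact ⟨Finset.disjoint_left.1 (g.disjoint A W) hx, W, rfl, x, hx, rfl⟩
  · rintro ⟨hx, V, rfl, y, hy, h⟩
    rwa [Finset.insert_left_injective_of_notMem hx h]

theorem Generates.next_nonempty (hg : g.Generates f) {A : Profile C} {W : Finset C}
    (hW : W.card < Fintype.card C) (hA : W ∈ f.chosen A W.card) : (g.next A W).Nonempty :=
  (hg A W.card hW).1 W hA

end GeneratorFunction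

/-- The ballot vectors that are obtained by adding sufficiently often `baseVec W` are realized by
profiles that make `W` the unique winning committee. -/
theorem eventually_separates_realizes [Nonempty C] {w : ℕ → ℕ → ℝ} {W : Finset C}
    (hw : ∀ k < W.card, LevelWeights f k (w k)) (z : Finset C → ℤ) (F : Finset ℕ+) :
    ∀ᶠ j : ℕ in atTop, Separates w W (z + j • baseVec W) ∧
      ∃ A : Profile C, A.Realizes (z + j • baseVec W) ∧ Disjoint A.voters F := by
  filter_upwards [(separates_baseVec (fun k hk => (hw k hk).nonneg)
    (fun k hk => (hw k hk).exists_pos)).eventually z, eventually_pos_baseVec W z] with j h1 h2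
  obtain ⟨c⟩ := ‹Nonempty C›
  exact ⟨h1, Profile.exists_realizes (fun S _ => (h2 S).le) ⟨{c}, by simp, h2 _⟩ F⟩

section Generator

variable [Nonempty C] {g : GeneratorFunction C} {w : ℕ → ℕ → ℝ} {W : Finset C}

omit [Nonempty C] in
-- Some y is selected, and swapping y with x preserves both W and the ballot counts.
theorem mem_next_of_realizes_baseVec (hg : g.Generates f) (hp : f.Proper)
    (hW : W.card < Fintype.card C) {A : Profile C} {j : ℕ} (hA : A.Realizes (j • baseVec W))
    (hAW : f.chosen A W.card = {W}) {x : C} (hx : x ∉ W) : x ∈ g.next A W := by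
  obtain ⟨y, hy⟩ := hg.next_nonempty hW (by rw [hAW]; rfl)
  rw [hg.mem_next_iff hW hAW] at hy ⊢
  refine ⟨hx, ?_⟩
  have hs : W.map (Equiv.swap y x).toEmbedding = W := Finset.map_swap_of_notMem hy.1 hx
  have h1 := hA.permuteCandidates (Equiv.swap y x)
  rw [map_nsmul, permVec_baseVec, hs] at h1
  rw [hp.anonymous.chosen_eq hA h1 hW, hp.neutral A _ _ hW]
  refine ⟨_, hy.2, ?_⟩
  dsimp only
  rw [Finset.map_insert, hs]
  congr 1
  exact Equiv.swap_apply_left y x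

/-- Since W need only be one of the winners for A, the generator there cannot be read off from f
directly. Adding a profile P of many copies of `baseVec W` makes W the unique winner, and
consistency leaves the generator unchanged because P selects every candidate outside W. The case j =
0 covers the given profile itself. -/
theorem mem_nextVec_iff (hc : g.Consistent) (hg : g.Generates f) (hp : f.Proper)
    (hW : W.card < Fintype.card C) (hw : ∀ k < W.card, LevelWeights f k (w k))
    {z : Finset C → ℤ} {j : ℕ} {A : Profile C} (hA : A.Realizes (z + j • baseVec W))
    (hAW : W ∈ f.chosen A W.card) {x : C} : x ∈ nextVec f W z ↔ x ∈ g.next A W := by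
  have hWu : W ≠ Finset.univ := fun h => by rw [h, Finset.card_univ] at hW; exact hW.false
  have key : ∀ᶠ i : ℕ in atTop, ∀ B : Profile C, B.Realizes (z + (i + j) • baseVec W) →
      (x ∈ g.next A W ↔ x ∉ W ∧ insert x W ∈ f.chosen B (W.card + 1)) := by
    filter_upwards [eventually_separates_realizes hw 0 A.voters,
      (tendsto_add_atTop_nat j).eventually (eventually_separates_realizes hw z ∅)] with i h1 h2 B hB
    obtain ⟨h3, P, hP, hPA⟩ := h1
    rw [zero_add] at h3 hP
    have hAP : (A.add P).Realizes (z + (i + j) • baseVec W) := by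
      rw [add_smul, add_comm (i • _), ← add_assoc]
      exact hA.add hP hPA.symm
    have h4 := h2.1.chosen_eq hw hAP
    have h5 := h3.chosen_eq hw hP
    have h6 : g.next A W ∩ g.next P W = g.next A W := Finset.inter_eq_left.2 fun u hu =>
      mem_next_of_realizes_baseVec hg hp hW hP h5 (Finset.disjoint_left.1 (g.disjoint A W) hu)
    have h7 := hc A P W hPA.symm hWu (by rw [h6]; exact hg.next_nonempty hW hAW)
      (hg.next_nonempty hW (by rw [h4]; rfl))
    rw [h6] at h7
    rw [← h7, hg.mem_next_iff hW h4, hp.anonymous.chosen_eq hAP hB hW]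
  constructor
  · rintro ⟨hx, h⟩
    obtain ⟨i, ⟨h1, h2⟩, -, B, hB, -⟩ := ((key.and ((tendsto_add_atTop_nat j).eventually h)).and
      ((tendsto_add_atTop_nat j).eventually (eventually_separates_realizes hw z ∅))).exists
    exact (h1 B hB).2 ⟨hx, h2 B hB⟩
  · intro hx
    refine ⟨Finset.disjoint_left.1 (g.disjoint A W) hx, ?_⟩
    obtain ⟨n, hn⟩ := eventually_atTop.1 key
    filter_upwards [eventually_ge_atTop (n + j)] with i hi B hB
    exact ((hn (i - j) (by omega) B (by rwa [Nat.sub_add_cancel (by omega)])).1 hx).2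

end Generator

/-- `nextVec` is equivariant under permutations of the candidates. -/
theorem apply_mem_nextVec (hp : f.Proper) {W : Finset C} (hW : W.card < Fintype.card C)
    (τ : Equiv.Perm C) {z : Finset C → ℤ} {x : C} (hx : x ∈ nextVec f W z) :
    τ x ∈ nextVec f (W.map τ.toEmbedding) (permVec τ z) := by
  refine ⟨by simpa using hx.1, ?_⟩
  filter_upwards [hx.2] with j hj A hA
  have hA' := hA.permuteCandidates τ⁻¹
  have h1 : permVec τ⁻¹ (permVec τ z + j • baseVec (W.map τ.toEmbedding)) = z + j • baseVec W := by
    rw [← permVec_baseVec, ← map_nsmul, ← map_add, ← permVec_mul, inv_mul_cancel, permVec_one]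
  have h2 := hA'.permuteCandidates τ
  rw [← permVec_mul, mul_inv_cancel, permVec_one] at h2
  rw [h1] at hA'
  rw [Finset.card_map, hp.anonymous.chosen_eq hA h2 hW, hp.neutral _ _ _ hW]
  refine ⟨_, hj _ hA', ?_⟩
  dsimp only
  rw [Finset.map_insert]
  rfl

theorem weaklyBeats_nextVec (hp : f.Proper) {W : Finset C} (hW : W.card < Fintype.card C)
    (τ : Equiv.Perm C) {z : Finset C → ℤ} {x y : C} (h : WeaklyBeats (nextVec f W) x y z) :
    WeaklyBeats (nextVec f (W.map τ.toEmbedding)) (τ x) (τ y) (permVec τ z) := by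
  obtain ⟨q, h1, h2, h3⟩ := h
  refine ⟨permVec τ q, apply_mem_nextVec hp hW τ h1, apply_mem_nextVec hp hW τ h2, ?_⟩
  rw [← map_add]
  exact apply_mem_nextVec hp hW τ h3

theorem weaklyBeats_nextVec_iff (hp : f.Proper) {W : Finset C} (hW : W.card < Fintype.card C)
    (τ : Equiv.Perm C) {z : Finset C → ℤ} {x y : C} :
    WeaklyBeats (nextVec f (W.map τ.toEmbedding)) (τ x) (τ y) (permVec τ z) ↔
      WeaklyBeats (nextVec f W) x y z := by
  refine ⟨fun h => ?_, weaklyBeats_nextVec hp hW τ⟩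
  have := weaklyBeats_nextVec hp (by rwa [Finset.card_map]) τ⁻¹ h
  rw [← permVec_mul, inv_mul_cancel, permVec_one, Finset.map_perm_map_perm, inv_mul_cancel,
    Finset.map_perm_one] at this
  simpa using this

/-- The profile in which only `i` votes. -/
def Profile.single (i : ℕ+) (S : Finset C) (hS : S.Nonempty) : Profile C where
  voters := {i}
  ballot j := if j = i then S else ∅
  voters_nonempty := Finset.singleton_nonempty i
  ballot_nonempty_iff j := by
    by_cases h : j = i <;> simp [h, hS]

omit [Fintype C] in
theorem Profile.realizes_single (i : ℕ+) (S : Finset C) (hS : S.Nonempty) :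
    (Profile.single i S hS).Realizes (Pi.single S 1) := by
  intro T _
  rw [count]
  by_cases h : T = S
  · subst h
    rw [Pi.single_eq_same, Finset.filter_true_of_mem]
    · rfl
    · intro j hj
      rw [Finset.mem_singleton.1 hj]
      exact if_pos rfl
  · rw [Pi.single_eq_of_ne h, Finset.filter_false_of_mem]
    · rfl
    · intro j hj
      rw [Finset.mem_singleton.1 hj]
      exact fun h' => h (h'.symm.trans (if_pos rfl))

/-- Each property is tested on profiles realizing z + j • `baseVec W` with j so large that W is the
unique winner. There the generator, the rule f and `nextVec` determine each other. -/
theorem regularChoice_nextVec [Nonempty C] {g : GeneratorFunction C} {w : ℕ → ℕ → ℝ}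
    {W : Finset C} (hc : g.Consistent) (hg : g.Generates f) (hp : f.Proper)
    (hl : f.IndependentOfLosers) (hW : W.card < Fintype.card C)
    (hw : ∀ k < W.card, LevelWeights f k (w k)) : RegularChoice W (nextVec f W) := by
  have hWu : W ≠ Finset.univ := fun h => by rw [h, Finset.card_univ] at hW; exact hW.false
  have hmem : ∀ {z : Finset C → ℤ} {j : ℕ} {A : Profile C}, Separates w W (z + j • baseVec W) →
      A.Realizes (z + j • baseVec W) → ∀ {x}, x ∈ nextVec f W z ↔ x ∈ g.next A W := by
    intro z j A hs hA x
    exact mem_nextVec_iff hc hg hp hW hw hA (by rw [hs.chosen_eq hw hA]; rfl)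
  constructor
  · exact fun h => h.1
  · intro z
    obtain ⟨j, hs, A, hA, -⟩ := (eventually_separates_realizes hw z ∅).exists
    obtain ⟨x, hx⟩ := hg.next_nonempty hW (by rw [hs.chosen_eq hw hA]; rfl)
    exact ⟨x, (hmem hs hA).2 hx⟩
  · intro x hx
    obtain ⟨j, hs, A, hA, -⟩ := (eventually_separates_realizes hw 0 ∅).exists
    rw [hmem hs hA]
    have hAW := hs.chosen_eq hw hA
    rw [zero_add] at hA
    exact mem_next_of_realizes_baseVec hg hp hW hA hAW hx
  · intro z z' y hy hy'
    obtain ⟨j, hs, A, hA, -⟩ := (eventually_separates_realizes hw z ∅).exists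
    obtain ⟨j', hs', A', hA', hd⟩ := (eventually_separates_realizes hw z' A.voters).exists
    have h1 := hA.add hA' hd.symm
    have h2 := hs.add hs'
    rw [add_add_add_comm, ← add_smul] at h1 h2
    have h3 := hc A A' W hd.symm hWu
      ⟨y, Finset.mem_inter.2 ⟨(hmem hs hA).1 hy, (hmem hs' hA').1 hy'⟩⟩
      (hg.next_nonempty hW (by rw [h2.chosen_eq hw h1]; rfl))
    ext x
    rw [Set.mem_inter_iff, hmem hs hA, hmem hs' hA', hmem h2 h1, h3, Finset.mem_inter]
  · intro a x ha z
    obtain ⟨j, ⟨hs, A, hA, -⟩, hpos⟩ :=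
      ((eventually_separates_realizes hw a ∅).and (eventually_pos_baseVec W a)).exists
    obtain ⟨i, hs', A', hA', hd⟩ := (eventually_separates_realizes hw z A.voters).exists
    have hAW := hs.chosen_eq hw hA
    have h1 : f.chosen A (W.card + 1) = {insert x W} := by
      have hnext : ∀ u, u ∈ g.next A W ↔ u = x := fun u => by
        rw [← hmem hs hA, ha, Set.mem_singleton_iff]
      rw [(hg A W.card hW).2, hAW]
      ext V
      constructor
      · rintro ⟨_, rfl, u, hu, rfl⟩
        rw [(hnext u).1 hu]; rfl
      · rintro rfl
        exact ⟨W, rfl, x, (hnext x).2 rfl, rfl⟩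
    have hxW : x ∉ W := by
      have : x ∈ nextVec f W a := by rw [ha]; rfl
      exact this.1
    obtain ⟨n, hn, hn'⟩ := hp.continuous A A' (W.card + 1) _ hd.symm hW h1
    obtain ⟨c⟩ := ‹Nonempty C›
    have hpos' : ∀ S, 0 < (n • (a + j • baseVec W)) S := fun S => by
      rw [Pi.smul_apply]; exact nsmul_pos (hpos S) (by omega)
    obtain ⟨B, hB, hBd⟩ := Profile.exists_realizes (fun S _ => (hpos' S).le)
      ⟨{c}, by simp, hpos' _⟩ A'.voters
    have hcop : Profile.IsCopies n A B := by
      rw [Profile.isCopies_iff]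
      intro S hS
      rw [hB S hS, Pi.smul_apply, Pi.smul_apply, hA S hS]
    have h2 := hn' B hcop hBd
    have h3 := hB.add hA' hBd
    have h4 := (hs.nsmul hn).add hs'
    -- The copies of A also multiply the added `baseVec W`, which is harmless since `nextVec` does
    -- not depend on how often it is added.
    have h5 : n • (a + j • baseVec W) + (z + i • baseVec W)
        = n • a + z + (n * j + i) • baseVec W := by
      rw [smul_add, add_add_add_comm, add_smul, mul_smul]
    rw [h5] at h3 h4
    refine ⟨n, hn, ?_⟩
    ext y
    rw [hmem h4 h3, hg.mem_next_iff hW (h4.chosen_eq hw h3), h2, Set.mem_singleton_iff,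
      Set.mem_singleton_iff]
    constructor
    · rintro ⟨hy, h⟩
      exact Finset.insert_left_injective_of_notMem hy h
    · rintro rfl
      exact ⟨hxW, rfl⟩
  · intro τ hτ z x hx
    have := apply_mem_nextVec hp hW τ hx
    rwa [hτ] at this
  · intro z x S R hx hxR hRW hSR
    have hS : S.Nonempty := hSR.mono Finset.sdiff_subset
    -- Both profiles share A, which has one ballot S fewer than required; voter 1 then casts S in
    -- one of them and S \ R in the other.
    obtain ⟨j, ⟨-, A, hA, hAd⟩, hs, hs'⟩ := ((eventually_separates_realizes hw
      (z - Pi.single S 1) {1}).and ((eventually_separates_realizes hw z ∅).and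
      (eventually_separates_realizes hw (z + (Pi.single (S \ R) 1 - Pi.single S 1)) ∅))).exists
    have h1 := hA.add (Profile.realizes_single 1 S hS) hAd
    have h2 := hA.add (Profile.realizes_single 1 (S \ R) hSR) hAd
    rw [show z - Pi.single S 1 + j • baseVec W + Pi.single S 1 = z + j • baseVec W by abel] at h1
    rw [show z - Pi.single S 1 + j • baseVec W + Pi.single (S \ R) 1
      = z + (Pi.single (S \ R) 1 - Pi.single S 1) + j • baseVec W by abel] at h2
    rw [hmem hs.1 h1, hg.mem_next_iff hW (hs.1.chosen_eq hw h1)] at hx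
    rw [hmem hs'.1 h2, hg.mem_next_iff hW (hs'.1.chosen_eq hw h2)]
    refine ⟨hx.1, ?_⟩
    rw [← Finset.card_insert_of_notMem hx.1]
    refine hl _ _ _ ?_ (fun i _ => ?_) (by rw [Finset.card_insert_of_notMem hx.1]; exact hx.2)
    · rfl
    · by_cases hi : i ∈ A.voters
      · simp [Profile.add, hi]
      · by_cases hi' : i = 1
        · subst hi'
          simp only [Profile.add, Profile.single, hi, if_false, if_true]
          refine ⟨?_, Finset.sdiff_subset⟩
          ext a
          simp only [Finset.mem_inter, Finset.mem_sdiff, Finset.mem_insert]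
          constructor
          · rintro ⟨h3, h4⟩
            refine ⟨h3, h4, ?_⟩
            rcases h3 with rfl | h3
            exacts [hxR, Finset.disjoint_right.1 hRW h3]
          · rintro ⟨h3, h4, -⟩
            exact ⟨h3, h4⟩
        · simp [Profile.add, Profile.single, hi, hi']

/-- Non-imposition makes W ∪ {y} the only winner for some D, but its predecessor V for D may be
another subset. Only one candidate u completes V, and a permutation carries V to W and u to y. -/
theorem exists_nextVec_eq_singleton [Nonempty C] {g : GeneratorFunction C} {w : ℕ → ℕ → ℝ}
    {W : Finset C} (hc : g.Consistent) (hg : g.Generates f) (hp : f.Proper)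
    (hW : W.card < Fintype.card C) (hw : ∀ k < W.card, LevelWeights f k (w k)) {y : C}
    (hy : y ∉ W) : ∃ a, nextVec f W a = {y} := by
  obtain ⟨D, hD⟩ := hp.nonImposing (insert y W)
  rw [Finset.card_insert_of_notMem hy] at hD
  have hgen := hg D W.card hW
  rw [hD] at hgen
  obtain ⟨V, hV⟩ := f.chosen_nonempty D W.card hW.le
  have hVcard := f.card_eq D _ V hV
  have hV' : V.card < Fintype.card C := by rwa [hVcard]
  have hVD : V ∈ f.chosen D V.card := by rwa [hVcard]
  obtain ⟨u, hu⟩ := hgen.1 V hV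
  have hins : ∀ v ∈ g.next D V, insert v V = insert y W := by
    intro v hv
    have : insert v V ∈ ({insert y W} : Set (Finset C)) := by
      rw [hgen.2]; exact ⟨V, hV, v, hv, rfl⟩
    exact this
  have hnext : nextVec f V D.count = {u} := by
    ext v
    rw [mem_nextVec_iff hc hg hp hV' (w := w) (by rwa [hVcard]) (j := 0) (A := D)
      (by rw [zero_smul, add_zero]; exact D.realizes_count) hVD, Set.mem_singleton_iff]
    refine ⟨fun hv => ?_, fun h => h ▸ hu⟩
    exact Finset.insert_left_injective_of_notMem (Finset.disjoint_left.1 (g.disjoint D V) hv)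
      ((hins v hv).trans (hins u hu).symm)
  have huV : u ∉ V := Finset.disjoint_left.1 (g.disjoint D V) hu
  obtain ⟨σ, hσ⟩ := exists_perm_map_eq hVcard
  have hσu : σ u ∉ W := by
    rw [← hσ]
    simpa using huV
  let τ := Equiv.swap (σ u) y * σ
  have hτ : V.map τ.toEmbedding = W := by
    rw [← Finset.map_perm_map_perm, hσ]
    exact Finset.map_swap_of_notMem hσu hy
  have hτu : τ u = y := by simp [τ]
  refine ⟨permVec τ D.count, ?_⟩
  have hmem : y ∈ nextVec f W (permVec τ D.count) := by
    rw [← hτ, ← hτu]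
    exact apply_mem_nextVec hp hV' τ (by rw [hnext]; rfl)
  ext v
  rw [Set.mem_singleton_iff]
  refine ⟨fun hv => ?_, fun h => h ▸ hmem⟩
  have := apply_mem_nextVec hp hW τ⁻¹ hv
  rw [← permVec_mul, inv_mul_cancel, permVec_one, ← hτ, Finset.map_perm_map_perm, inv_mul_cancel,
    Finset.map_perm_one, hnext] at this
  rw [← hτu, ← Set.mem_singleton_iff.1 this]
  simp

/-- The induction step of the characterisation. -/
theorem exists_levelWeights_step [Nonempty C] {g : GeneratorFunction C} {w : ℕ → ℕ → ℝ} {k : ℕ}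
    (hc : g.Consistent) (hg : g.Generates f) (hp : f.Proper) (hl : f.IndependentOfLosers)
    (hk : k < Fintype.card C) (hw : ∀ i < k, LevelWeights f i (w i)) :
    ∃ v, LevelWeights f k v := by
  rcases Nat.lt_or_ge (k + 1) (Fintype.card C) with hk' | hk'
  · obtain ⟨W₀, -, hW₀⟩ := Finset.exists_subset_card_eq (s := (Finset.univ : Finset C)) hk.le
    obtain ⟨x₀, hx₀, y₀, hy₀, hne₀⟩ : ∃ x ∈ W₀ᶜ, ∃ y ∈ W₀ᶜ, x ≠ y := by
      rw [← Finset.one_lt_card, Finset.card_compl, hW₀]; omega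
    rw [Finset.mem_compl] at hx₀ hy₀
    subst hW₀
    obtain ⟨v, hv0, hv1, hv⟩ := (regularChoice_nextVec hc hg hp hl hk hw).exists_weights
      (fun y hy => exists_nextVec_eq_singleton hc hg hp hk hw hy) hx₀ hy₀ hne₀
    refine ⟨v, hv0, fun _ => hv1, fun A => ?_⟩
    rw [(hg A _ hk).2]
    ext W'
    simp only [Set.mem_ofPred_eq]
    refine exists_congr fun W => and_congr_right fun hW => exists_congr fun x => ?_
    have hcard := f.card_eq A _ W hW
    have hWC : W.card < Fintype.card C := by rwa [hcard]
    have hw' : ∀ i < W.card, LevelWeights f i (w i) := by rwa [hcard]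
    rw [← and_assoc]
    refine and_congr_left fun _ => ?_
    rw [← mem_nextVec_iff hc hg hp hWC hw' (j := 0) (A := A) (z := A.count)
      (by rw [zero_smul, add_zero]; exact A.realizes_count) (by rwa [hcard])]
    by_cases hx : x ∈ W
    · exact iff_of_false (fun h => h.1 hx) fun h => h.1 hx
    rw [and_iff_right hx, (regularChoice_nextVec hc hg hp hl hWC hw').mem_iff_weaklyBeats hx]
    refine forall₂_congr fun y hy => ?_
    by_cases hxy : y = x
    · simp [hxy]
    -- The weights come from one reference triple; neutrality transports the comparison of x and y
    -- at W to it.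
    obtain ⟨τ, h1, h2, h3⟩ := exists_perm_map_eq_apply_eq hcard hx hy (Ne.symm hxy) hx₀ hy₀ hne₀
    rw [← weaklyBeats_nextVec_iff hp hWC τ, ← gain_permVec v τ A.count W y,
      ← gain_permVec v τ A.count W x, h1, h2, h3, hv]
    exact ⟨fun h => h hxy, fun h _ => h⟩
  -- In the last step only one candidate is left, so zero weights suffice.
  · refine ⟨0, fun _ => le_rfl, fun h => absurd h (by omega), fun A => ?_⟩
    rw [(hg A k hk).2]
    ext W'
    simp only [Set.mem_ofPred_eq]
    refine exists_congr fun W => and_congr_right fun hW => exists_congr fun x => ?_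
    have hcard := f.card_eq A k W hW
    rw [← and_assoc]
    refine and_congr_left fun _ => ?_
    have hgain : ∀ y, gain 0 A.count W y = 0 := fun y => by simp [gain]
    simp only [hgain, le_refl, implies_true, and_true]
    refine ⟨fun h => Finset.disjoint_left.1 (g.disjoint A W) h, fun hx => ?_⟩
    obtain ⟨u, hu⟩ := (hg A k hk).1 W hW
    have huW := Finset.disjoint_left.1 (g.disjoint A W) hu
    have h1 : (Wᶜ).card ≤ 1 := by rw [Finset.card_compl]; omega
    rwa [Finset.card_le_one.1 h1 x (Finset.mem_compl.2 hx) u (Finset.mem_compl.2 huW)]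

theorem exists_levelWeights [Nonempty C] (hm : f.ConsistentlyCommitteeMonotone) (hp : f.Proper)
    (hl : f.IndependentOfLosers) :
    ∃ w : ℕ → ℕ → ℝ, ∀ k < Fintype.card C, LevelWeights f k (w k) := by
  obtain ⟨g, hc, hg⟩ := hm
  have key : ∀ k, ∃ v, k < Fintype.card C → LevelWeights f k v := by
    intro k
    induction k using Nat.strong_induction_on with
    | _ k ih =>
      by_cases hk : k < Fintype.card C
      · choose! w hw using ih
        obtain ⟨v, hv⟩ := exists_levelWeights_step hc hg hp hl hk
          (w := w) (fun i hi => hw i hi (hi.trans hk))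
        exact ⟨v, fun _ => hv⟩
      · exact ⟨0, fun h => absurd h hk⟩
  choose w hw using key
  exact ⟨w, hw⟩

end Backward

/-! ### Separability makes the weights proportional -/

theorem mul_le_mul_of_forall_nat {a b c d : ℝ} (hb : 0 < b) (hd : 0 < d)
    (h : ∀ p q : ℕ, q * a ≤ p * b → q * c ≤ p * d) (ha : 0 ≤ a) : c * b ≤ a * d := by
  by_contra! hlt
  have h1 : a / b < c / d := (div_lt_div_iff₀ hb hd).2 hlt
  -- The gap between a / b and c / d exceeds 1 / n, so the least multiple of 1 / n that is at least
  -- a / b lies below c / d.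
  obtain ⟨n, hn⟩ := exists_nat_gt (1 / (c / d - a / b))
  rw [div_lt_iff₀ (sub_pos.2 h1)] at hn
  have h2 := Nat.le_ceil (n * (a / b))
  have h3 := Nat.ceil_lt_add_one (show 0 ≤ n * (a / b) by positivity)
  have h4 := h ⌈n * (a / b)⌉₊ n (by
    calc (n : ℝ) * a = n * (a / b) * b := by field_simp
      _ ≤ _ := mul_le_mul_of_nonneg_right h2 hb.le)
  have h5 : (⌈n * (a / b)⌉₊ : ℝ) < n * (c / d) := by linarith
  have h6 := mul_lt_mul_of_pos_right h5 hd
  have h7 : (n : ℝ) * (c / d) * d = n * c := by field_simp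
  linarith

theorem mul_le_mul_of_forall_nat' {a b c d : ℝ} (hb : 0 < b) (hd : 0 < d)
    (h : ∀ p q : ℕ, p * b ≤ q * a → p * d ≤ q * c) (ha : 0 ≤ a) : a * d ≤ c * b := by
  by_contra! hlt
  have h1 : c / d < a / b := (div_lt_div_iff₀ hd hb).2 hlt
  obtain ⟨n, hn⟩ := exists_nat_gt (1 / (a / b - c / d))
  rw [div_lt_iff₀ (sub_pos.2 h1)] at hn
  have h2 := Nat.floor_le (show 0 ≤ n * (a / b) by positivity)
  have h3 := Nat.lt_floor_add_one (n * (a / b))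
  have h4 := h ⌊n * (a / b)⌋₊ n (by
    calc _ ≤ (n : ℝ) * (a / b) * b := mul_le_mul_of_nonneg_right h2 hb.le
      _ = n * a := by field_simp)
  have h5 : n * (c / d) < (⌊n * (a / b)⌋₊ : ℝ) := by linarith
  have h6 := mul_lt_mul_of_pos_right h5 hd
  have h7 : (n : ℝ) * (c / d) * d = n * c := by field_simp
  linarith

section Separability

variable {C : Type*} [Fintype C] [DecidableEq C] {f : ABCRule C} {w : ℕ → ℕ → ℝ}

/-- One vote for every singleton that is contained in `W`. -/
def singletonVec (W : Finset C) : Finset C → ℤ := ∑ v ∈ W, Pi.single {v} 1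

theorem gain_singletonVec (u : ℕ → ℝ) (W V : Finset C) (x : C) :
    gain u (singletonVec W) V x = if x ∈ W then u (({x} : Finset C) ∩ V).card else 0 := by
  induction W using Finset.induction_on with
  | empty => simp [singletonVec, gain_zero]
  | insert v W hv ih =>
    rw [singletonVec, Finset.sum_insert hv, gain_add, gain_single]
    rw [singletonVec] at ih
    rw [ih]
    by_cases hx : x = v
    · subst hx; simp [hv]
    · simp [hx]

omit [Fintype C] in
theorem singletonVec_nonneg (W S : Finset C) : 0 ≤ singletonVec W S := by
  rw [singletonVec, Finset.sum_apply]
  exact Finset.sum_nonneg fun v _ =>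
    (Pi.single_nonneg.2 zero_le_one : (0 : Finset C → ℤ) ≤ Pi.single {v} 1) S

/-- Unlike `baseVec W`, this vector approves no candidate outside W, which allows control over the
approved candidates of each part of the electorate. -/
theorem separates_singletonVec {W : Finset C} (h : ∀ k < W.card, 0 < w k 0) :
    Separates w W (singletonVec W) := by
  intro V hV x hx hxV y hy
  rw [gain_singletonVec, gain_singletonVec, if_neg hy, if_pos hx,
    Finset.singleton_inter_of_notMem hxV]
  exact h _ (Finset.card_lt_card ⟨hV, fun h => hxV (h hx)⟩)

theorem Profile.mem_approved_iff (A : Profile C) (x : C) :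
    x ∈ A.approved ↔ 0 < gain (fun _ => 1) A.count ∅ x := by
  rw [gain_count, approved, Finset.mem_biUnion, Finset.sum_boole, Nat.cast_pos, Finset.card_pos]
  exact ⟨fun ⟨i, hi, hx⟩ => ⟨i, Finset.mem_filter.2 ⟨hi, hx⟩⟩,
    fun ⟨i, hi⟩ => ⟨i, Finset.mem_filter.1 hi⟩⟩

/-- Separability transfers comparisons of multiples of weights to the previous step. -/
theorem mul_weights_le_of_separable (hw : ∀ k < Fintype.card C, LevelWeights f k (w k))
    (hsep : f.CommitteeSeparable) {k : ℕ} (hk : k + 2 < Fintype.card C)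
    (hpos : ∀ i ≤ k, 0 < w i 0) {s t : ℕ} (hs : s ≤ k) (ht : t ≤ k) (p q : ℕ)
    (h : q * w (k + 1) t ≤ p * w (k + 1) s) : q * w k t ≤ p * w k s := by
  obtain ⟨V, -, hV⟩ := Finset.exists_subset_card_eq (s := (Finset.univ : Finset C))
    (show k ≤ _ by rw [Finset.card_univ]; omega)
  obtain ⟨b, x, y, hb, hx, hy, hbx, hby, hxy⟩ : ∃ b x y, b ∈ Vᶜ ∧ x ∈ Vᶜ ∧ y ∈ Vᶜ ∧
      b ≠ x ∧ b ≠ y ∧ x ≠ y := by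
    rw [← Finset.two_lt_card_iff, Finset.card_compl]; omega
  rw [Finset.mem_compl] at hb hx hy
  obtain ⟨S, hS, hSs⟩ := Finset.exists_subset_card_eq (hs.trans hV.ge)
  obtain ⟨T, hT, hTt⟩ := Finset.exists_subset_card_eq (ht.trans hV.ge)
  -- The ballot {b}ᶜ makes everyone except b approved and does not discriminate among them. The p
  -- and q further ballots are worth weights at s to x and at t to y.
  let z : Finset C → ℤ := Pi.single {b}ᶜ 1 + p • Pi.single (insert x S) 1 +
    q • Pi.single (insert y T) 1
  have h1 : ∀ U : Finset C, (0 : Finset C → ℤ) ≤ Pi.single U 1 := fun U =>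
    Pi.single_nonneg.2 zero_le_one
  have hz0 : ∀ U, 0 ≤ z U := fun U => add_nonneg (add_nonneg (h1 _ U) (nsmul_nonneg (h1 _ U) _))
    (nsmul_nonneg (h1 _ U) _)
  have hz1 : 0 < z {b}ᶜ := add_pos_of_pos_of_nonneg (add_pos_of_pos_of_nonneg (by simp)
    (nsmul_nonneg (h1 _ _) _)) (nsmul_nonneg (h1 _ _) _)
  have hgain : ∀ (v : ℕ → ℝ) (j : ℕ) (W U : Finset C) (c : C),
      gain v (z + j • singletonVec W) U c = (if c ≠ b then v (({b}ᶜ : Finset C) ∩ U).card else 0)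
        + p * (if c ∈ insert x S then v (insert x S ∩ U).card else 0)
        + q * (if c ∈ insert y T then v (insert y T ∩ U).card else 0)
        + j * (if c ∈ W then v (({c} : Finset C) ∩ U).card else 0) := by
    intro v j W U c
    simp only [z, gain_add, gain_nsmul, gain_single, gain_singletonVec, Finset.mem_compl,
      Finset.mem_singleton, Int.cast_one, one_mul]
  have hcardW : (insert b V).card = k + 1 := by rw [Finset.card_insert_of_notMem hb, hV]
  -- The singletons of V go to A and that of b to B. With many of them, V is the unique winner of
  -- size k for A, and V ∪ {b} that of size k + 1 for A + B.
  obtain ⟨j, ⟨hsW, hsV⟩, hj⟩ := (((separates_singletonVec (w := w) (W := insert b V) (fun i hi =>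
    hpos i (by omega))).eventually z).and ((separates_singletonVec (w := w) (W := V) (fun i hi =>
    hpos i (by omega))).eventually z) |>.and (eventually_ge_atTop 1)).exists
  obtain ⟨A, hA, -⟩ := Profile.exists_realizes (z := z + j • singletonVec V)
    (fun U _ => add_nonneg (hz0 U) (nsmul_nonneg (singletonVec_nonneg V U) j))
    ⟨{b}ᶜ, ⟨x, by simpa using hbx.symm⟩,
      add_pos_of_pos_of_nonneg hz1 (nsmul_nonneg (singletonVec_nonneg V _) j)⟩ ∅
  obtain ⟨B, hB, hBA⟩ := Profile.exists_realizes (z := j • singletonVec {b})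
    (fun U _ => nsmul_nonneg (singletonVec_nonneg _ U) j)
    ⟨{b}, by simp, by simpa [singletonVec] using Nat.succ_le_iff.1 hj⟩ A.voters
  have hAB : (A.add B).Realizes (z + j • singletonVec (insert b V)) := by
    have : z + j • singletonVec (insert b V) = z + j • singletonVec V + j • singletonVec {b} := by
      have h1 : singletonVec (insert b V) = singletonVec V + singletonVec {b} := by
        rw [singletonVec, Finset.sum_insert hb, singletonVec, singletonVec, Finset.sum_singleton,
          add_comm]
      rw [h1, smul_add, ← add_assoc]
    rw [this]
    exact hA.add hB hBA.symm
  have hcA : ∀ (v : ℕ → ℝ) (U : Finset C) (c : C),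
      gain v A.count U c = gain v (z + j • singletonVec V) U c :=
    fun v U c => gain_congr v U c hA
  have hcAB : ∀ (v : ℕ → ℝ) (U : Finset C) (c : C),
      gain v (A.add B).count U c = gain v (z + j • singletonVec (insert b V)) U c :=
    fun v U c => gain_congr v U c hAB
  have happA : A.approved = {b}ᶜ := by
    ext c
    rw [A.mem_approved_iff, hcA, hgain, Finset.mem_compl, Finset.mem_singleton]
    by_cases hc : c = b
    · subst hc
      have h1 : c ∉ S := fun h => hb (hS h)
      have h2 : c ∉ T := fun h => hb (hT h)
      simp [h1, h2, hb, hbx, hby]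
    · rw [if_pos hc]
      refine iff_of_true ?_ hc
      have h1 : ∀ P : Prop, ∀ [Decidable P], (0 : ℝ) ≤ if P then 1 else 0 := by
        intro P _; split_ifs <;> norm_num
      have h2 := mul_nonneg (Nat.cast_nonneg (α := ℝ) p) (h1 (c ∈ insert x S))
      have h3 := mul_nonneg (Nat.cast_nonneg (α := ℝ) q) (h1 (c ∈ insert y T))
      have h4 := mul_nonneg (Nat.cast_nonneg (α := ℝ) j) (h1 (c ∈ V))
      linarith
  have happB : B.approved = A.approvedᶜ := by
    rw [happA, compl_compl]
    ext c
    rw [B.mem_approved_iff, gain_congr _ _ _ hB, gain_nsmul, gain_singletonVec]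
    have : (0 : ℝ) < j := by exact_mod_cast hj
    by_cases hc : c = b <;> simp [hc, this]
  have hAV : f.chosen A V.card = {V} := hsV.chosen_eq (fun i hi => hw i (by omega)) hA
  have hABW : f.chosen (A.add B) (insert b V).card = {insert b V} :=
    hsW.chosen_eq (fun i hi => hw i (by omega)) hAB
  rw [hV] at hAV
  rw [hcardW] at hABW
  have hxW : x ∉ insert b V := by simp [hbx.symm, hx]
  have hyW : y ∉ insert b V := by simp [hby.symm, hy]
  have hnn := (hw (k + 1) (by omega)).nonneg
  have hxT : x ∉ T := fun h => hx (hT h)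
  have hyS : y ∉ S := fun h => hy (hS h)
  have hSW : insert x S ∩ insert b V = S := by
    rw [Finset.insert_inter_of_notMem hxW]
    exact Finset.inter_eq_left.2 (hS.trans (Finset.subset_insert b V))
  have hTW : insert y T ∩ insert b V = T := by
    rw [Finset.insert_inter_of_notMem hyW]
    exact Finset.inter_eq_left.2 (hT.trans (Finset.subset_insert b V))
  have hSV : insert x S ∩ V = S := by
    rw [Finset.insert_inter_of_notMem hx]
    exact Finset.inter_eq_left.2 hS
  have hTV : insert y T ∩ V = T := by
    rw [Finset.insert_inter_of_notMem hy]
    exact Finset.inter_eq_left.2 hT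
  -- By assumption x is optimal at V ∪ {b}. Separability then makes x optimal for A at V, which is
  -- the conclusion.
  have hmem : insert x (insert b V) ∈ f.chosen (A.add B) (insert x (insert b V)).card := by
    rw [Finset.card_insert_of_notMem hxW, hcardW, (hw (k + 1) (by omega)).chosen_succ, hABW]
    refine ⟨_, rfl, x, hxW, fun c hc => ?_, rfl⟩
    have hcb : c ≠ b := fun h => hc (by simp [h])
    have hcS : c ∉ S := fun h => hc (Finset.mem_insert_of_mem (hS h))
    have hcT : c ∉ T := fun h => hc (Finset.mem_insert_of_mem (hT h))
    rw [hcAB, hcAB, hgain, hgain, if_pos hcb, if_pos hbx.symm, if_neg hc, if_neg hxW, hSW, hTW,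
      hSs, hTt, if_pos (Finset.mem_insert_self x S), if_neg (show x ∉ insert y T by simp [hxy, hxT])]
    have h1 : 0 ≤ (p : ℝ) * w (k + 1) s := mul_nonneg (Nat.cast_nonneg _) (hnn s)
    by_cases hcx : c = x
    · subst hcx
      simp [hcT, hxy]
    · rw [if_neg (show c ∉ insert x S by simp [hcx, hcS])]
      by_cases hcy : c = y
      · rw [if_pos (by simp [hcy])]
        linarith
      · rw [if_neg (show c ∉ insert y T by simp [hcy, hcT])]
        linarith
  have hsepA := (hsep A B _ hBA.symm happB hmem).1
  have hint : insert x (insert b V) ∩ A.approved = insert x V := by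
    rw [happA]
    ext c
    simp only [Finset.mem_inter, Finset.mem_insert, Finset.mem_compl, Finset.mem_singleton]
    constructor
    · rintro ⟨h1, h2⟩
      tauto
    · rintro (rfl | h1)
      · exact ⟨Or.inl rfl, hbx.symm⟩
      · exact ⟨Or.inr (Or.inr h1), fun h => hb (h ▸ h1)⟩
  rw [hint, Finset.card_insert_of_notMem hx, hV, (hw k (by omega)).chosen_succ, hAV] at hsepA
  obtain ⟨_, rfl, u, -, hmax, hu⟩ := hsepA
  have hxu := Finset.insert_left_injective_of_notMem hx hu
  subst hxu
  have h1 := hmax y hy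
  rw [hcA, hcA, hgain, hgain, if_pos hby.symm, if_pos hbx.symm, if_neg hy, if_neg hx, hSV, hTV,
    hSs, hTt, if_pos (Finset.mem_insert_self y T), if_pos (Finset.mem_insert_self x S),
    if_neg (show x ∉ insert y T by simp [hxy, hxT]),
    if_neg (show y ∉ insert x S by simp [hxy.symm, hyS])] at h1
  linarith

/-- If the weight at 0 vanished in step k + 1, transferring the comparison with p = 0 and q = 1
would make it vanish in step k. -/
theorem weights_zero_pos (hw : ∀ k < Fintype.card C, LevelWeights f k (w k))
    (hsep : f.CommitteeSeparable) (k : ℕ) (hk : k + 1 < Fintype.card C) : 0 < w k 0 := by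
  induction k using Nat.strong_induction_on with
  | _ k ih =>
    rcases k with _ | k
    · obtain ⟨t, ht, h⟩ := (hw 0 (by omega)).exists_pos hk
      rwa [Nat.le_zero.1 ht] at h
    · refine lt_of_le_of_ne ((hw (k + 1) (by omega)).nonneg 0) fun h0 => ?_
      have h1 := mul_weights_le_of_separable hw hsep hk (fun i hi => ih i (by omega) (by omega))
        (Nat.zero_le k) (Nat.zero_le k) 0 1 (by rw [← h0]; simp)
      have h2 := ih k (by omega) (by omega)
      simp only [Nat.cast_one, one_mul, Nat.cast_zero, zero_mul] at h1
      linarith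

/-- Up to a positive factor, the weights of one step extend those of the previous step. -/
theorem weights_proportional (hw : ∀ k < Fintype.card C, LevelWeights f k (w k))
    (hsep : f.CommitteeSeparable) {k t : ℕ} (hk : k + 2 < Fintype.card C) (ht : t ≤ k) :
    w (k + 1) t * w k 0 = w (k + 1) 0 * w k t := by
  have hpos : ∀ i ≤ k + 1, 0 < w i 0 := fun i hi => weights_zero_pos hw hsep i (by omega)
  have h1 : ∀ {s t : ℕ}, s ≤ k → t ≤ k → ∀ p q : ℕ,
      q * w (k + 1) t ≤ p * w (k + 1) s → q * w k t ≤ p * w k s :=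
    mul_weights_le_of_separable hw hsep hk (fun i hi => hpos i (by omega))
  have ha := (hw (k + 1) (by omega)).nonneg t
  have h2 := mul_le_mul_of_forall_nat (hpos (k + 1) le_rfl) (hpos k (by omega))
    (fun p q => h1 (Nat.zero_le k) ht p q) ha
  have h3 := mul_le_mul_of_forall_nat' (hpos (k + 1) le_rfl) (hpos k (by omega))
    (fun p q => h1 ht (Nat.zero_le k) q p) ha
  linarith

theorem gain_const_mul (r : ℝ) (v : ℕ → ℝ) (z : Finset C → ℤ) (W : Finset C) (x : C) :
    gain (fun t => r * v t) z W x = r * gain v z W x := by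
  rw [gain, gain, Finset.mul_sum]
  refine Finset.sum_congr rfl fun S _ => ?_
  split_ifs <;> ring

theorem exists_common_weights (hw : ∀ k < Fintype.card C, LevelWeights f k (w k))
    (hsep : f.CommitteeSeparable) :
    ∃ v : ℕ → ℝ, 0 < v 0 ∧ ∀ k < Fintype.card C, LevelWeights f k v := by
  have hpos := weights_zero_pos hw hsep
  -- The normalised weight at t is read off in step t, the first one in which t occurs. The value at
  -- 0 is set separately to remain positive even if m = 1.
  let v : ℕ → ℝ := fun t => if t = 0 then 1 else if t + 1 < Fintype.card C then w t t / w t 0 else 0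
  have hv0 : v 0 = 1 := rfl
  have hvnn : ∀ t, 0 ≤ v t := by
    intro t
    simp only [v]
    split_ifs with h1 h2
    · exact zero_le_one
    · exact div_nonneg ((hw t (by omega)).nonneg t) ((hw t (by omega)).nonneg 0)
    · exact le_rfl
  have key : ∀ t k, t ≤ k → k + 1 < Fintype.card C → w k t = w k 0 * v t := by
    intro t k htk
    induction k, htk using Nat.le_induction with
    | base =>
      intro ht
      have := hpos t ht
      by_cases h0 : t = 0
      · subst h0; rw [hv0, mul_one]
      · simp only [v, h0, if_false, ht, if_true]
        field_simp
    | succ k htk ih =>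
      intro hk
      have h1 := weights_proportional hw hsep hk htk
      rw [ih (by omega)] at h1
      have h2 := hpos k (by omega)
      refine mul_right_cancel₀ h2.ne' ?_
      rw [h1]; ring
  refine ⟨v, by rw [hv0]; exact one_pos, fun k hk => ⟨hvnn, fun _ => ⟨0, Nat.zero_le k, by
    rw [hv0]; exact one_pos⟩, fun A => ?_⟩⟩
  rw [(hw k hk).chosen_succ]
  ext W'
  simp only [Set.mem_ofPred_eq]
  refine exists_congr fun W => and_congr_right fun hW => exists_congr fun x =>
    and_congr_right fun hx => and_congr_left fun _ => forall₂_congr fun y hy => ?_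
  have hc := f.card_eq A k W hW
  rcases Nat.lt_or_ge (k + 1) (Fintype.card C) with hk' | hk'
  · have h1 : ∀ t ≤ W.card, w k t = w k 0 * v t := fun t ht => key t k (by omega) hk'
    rw [gain_weights_congr h1, gain_weights_congr h1, gain_const_mul, gain_const_mul,
      mul_le_mul_iff_right₀ (hpos k hk')]
  -- The weights of the last step need not be proportional, but there is nothing to compare.
  · have h1 : (Wᶜ).card ≤ 1 := by rw [Finset.card_compl]; omega
    have h2 := Finset.card_le_one.1 h1 x (Finset.mem_compl.2 hx) y (Finset.mem_compl.2 hy)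
    rw [h2]
    simp

end Separability

/-! ### The two characterisations -/

theorem mainTheorem2 {C : Type*} [Fintype C] [DecidableEq C] [Nonempty C] (f : ABCRule C) :
    (f.IsStepDependentSequentialThieleRule ↔
      f.ConsistentlyCommitteeMonotone ∧ f.IndependentOfLosers ∧ f.Proper) ∧
    (f.IsSequentialThieleRule ↔
      f.ConsistentlyCommitteeMonotone ∧ f.IndependentOfLosers ∧ f.CommitteeSeparable ∧
        f.Proper) := by
  rw [isStepDependentSequentialThieleRule_iff, isSequentialThieleRule_iff]
  refine ⟨⟨?_, fun ⟨h1, h2, h3⟩ => exists_levelWeights h1 h3 h2⟩, ?_, ?_⟩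
  · rintro ⟨w, hw⟩
    exact ⟨LevelWeights.consistentlyCommitteeMonotone hw, LevelWeights.independentOfLosers hw,
      LevelWeights.proper hw⟩
  · rintro ⟨v, -, hv⟩
    have hv' : ∀ k < Fintype.card C, LevelWeights f k ((fun _ => v : ℕ → ℕ → ℝ) k) := hv
    exact ⟨LevelWeights.consistentlyCommitteeMonotone hv', LevelWeights.independentOfLosers hv',
      LevelWeights.committeeSeparable hv, LevelWeights.proper hv'⟩
  · rintro ⟨h1, h2, h3, h4⟩
    obtain ⟨w, hw⟩ := exists_levelWeights h1 h4 h2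
    exact exists_common_weights hw h3
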